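/- Fix a finite alphabet $\Sigma$ and a set $\mathbb X$ of variables. Let $\Phi$ consist of word equations $s_i=t_i$ ($1\le i\le m$), with $s_i\neq t_i$ in $\mathbb X^*$ and $\{s_i,t_i\}\ne\{s_j,t_j\}$ for $i\ne j$, and of regular constraints $x\in L(\mathsf{Aut}_\Phi(x))$ for $x\in\mathbb X$, where $\mathsf{Aut}_\Phi(x)$ is an NFA without $\epsilon$-transitions. For an automata assignment $\mathsf{Aut}$ and a term $t=x_1\cdots x_n$ let $\mathsf{Aut}(t)$ be the $\epsilon$-concatenation of $\mathsf{Aut}(x_1),\dots,\mathsf{Aut}(x_n)$ (disjoint union, with $\epsilon$-transitions from the final states of each automaton to the initial states of the next). An inclusion graph is a directed graph $G=(V,E)$ whose vertices are inclusions $s_i\subseteq t_i$ or $t_i\subseteq s_i$ such that (1) for each $i$ at least one of the two is in $V$; (2) if $(s\subseteq t)\in V$ and $t$ has a variable with multiple occurrences in the right-hand sides of vertices of $V$, then $(t\subseteq s)\in V$; (3) there is an edge from $(s\subseteq t)\in V$ to $(s'\subseteq t')\in V$ iff $s$ and $t'$ share a variable; (4) if $(s\subseteq t)\in V$ lies on a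 cycle, then $(t\subseteq s)\in V$. $\mathtt{propagate}(G,\mathsf{Aut}_\Phi)$ keeps a first-in first-out queue of pairs $(\mathsf{Aut},W)$, with $W$ a first-in first-out queue of vertices; initially it holds only $(\mathsf{Aut}_\Phi,V)$, $V$ in any order. While the queue is nonempty, it dequeues a pair $(\mathsf{Aut},W)$. If $W=\emptyset$, it returns SAT. Otherwise it dequeues $v=(s\subseteq t)$ from $W$; if $L(\mathsf{Aut}(s))\subseteq L(\mathsf{Aut}(t))$, it enqueues $(\mathsf{Aut},W)$; if not, it enqueues $(\mathsf{Aut}',W')$ for each $\mathsf{Aut}'\in\mathtt{refine}(v,\mathsf{Aut})$, where $W'$ is $W$ followed by the successors of $v$ in $G$ that are not in $W$. When the queue is empty, it returns UNSAT. $\mathtt{refine}(v,\mathsf{Aut})$, for $s=x_1\cdots x_n$, forms the $\epsilon$-preserving product $\Pi$ of $\mathsf{Aut}(s)$ with an equivalent $\epsilon$-free automaton for $\mathsf{Aut}(t)$ (obtained by any fixed reduction method). For each tuple of $n-1$ $\epsilon$-transitions $q_j\to r_j$ ($1\le j<n$) occurring in this order in an accepting run of $\Pi$, let $N(j)$ be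 $\Pi$ trimmed after its initial states are replaced by $\{r_{j-1}\}$ and its final states by $\{q_j\}$ (for $j=1$ the initial states, and for $j=n$ the final states, are kept). Put $\mathsf{Aut}'(x)=\bigcap\{N(j): x_j=x\}$ for $x$ occurring in $s$ and $\mathsf{Aut}'(x)=\mathsf{Aut}(x)$ otherwise. The result is the set of those $\mathsf{Aut}'$ with $L(\mathsf{Aut}'(s))\neq\emptyset$. The splitting graph has as nodes all inclusions $s_i\subseteq t_i$ and $t_i\subseteq s_i$, with an edge from $s\subseteq t$ to $s'\subseteq t'$ if $s$ and $t'$ have different occurrences (different positions, sides or equations) of the same variable. $\Phi$ is chain-free if this graph has no cycle. The algorithm $\mathtt{incl}$ starts from the splitting graph and, as long as some remaining vertex $v$ has no incoming edge (loops included) from the remaining vertices, selects such a $v$ and removes $v$ and its dual inclusion. It returns the graph, with the edges given by (3), on the selected and the remaining vertices. Theorem. (a) If an inclusion graph $G$ is acyclic, then $\mathtt{propagate}(G,\mathsf{Aut}_\Phi)$ terminates, whatever orders are used to enqueue the elements of sets. (b) Consequently (with the soundness of $\mathtt{propagate}$), $\mathtt{incl}$ followed by $\mathtt{propagate}$ is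 a complete decision procedure for chain-free $\Phi$: if $\Phi$ is chain-free, then $\mathtt{incl}$ terminates, each graph $G$ that it can return is an acyclic inclusion graph, and $\mathtt{propagate}(G,\mathsf{Aut}_\Phi)$ terminates with SAT or UNSAT; if it returns UNSAT, then $\Phi$ has no solution, and if it returns SAT and all the languages $L(\mathsf{Aut}_\Phi(x))$ are nonempty, then $\Phi$ has a solution. (If some $L(\mathsf{Aut}_\Phi(x))$ is empty, $\Phi$ trivially has no solution.) -/

import Mathlib

/-! ### Finite automata with ε-transitions -/

/-- A nondeterministic finite automaton over `A`, with ε-transitions (labelled `none`):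
Mathlib's `εNFA` together with a finite set of states. -/
structure FinNFA (A : Type*) where
  State : Type
  finite : Finite State
  nfa : εNFA A State

namespace FinNFA

variable {A : Type*}

/-- The language of an automaton. -/
def lang (M : FinNFA A) : Language A := M.nfa.accepts

/-- The automaton has no ε-transitions. -/
def EpsFree (M : FinNFA A) : Prop := ∀ q, M.nfa.step q none = ∅

/-- The automaton accepting exactly the empty word. -/
def unit (A : Type*) : FinNFA A where
  State := Unit
  finite := inferInstance
  nfa := { step := fun _ _ => ∅, start := Set.univ, accept := Set.univ }

/-- ε-concatenation: disjoint union, with an ε-transition from every final state of the first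
automaton to every initial state of the second one. -/
def concat (M N : FinNFA A) : FinNFA A where
  State := M.State ⊕ N.State
  finite := by
    have := M.finite
    have := N.finite
    infer_instance
  nfa :=
    { step := fun q a =>
        match q with
        | Sum.inl p =>
            {r | (∃ p' ∈ M.nfa.step p a, r = Sum.inl p') ∨
              (a = none ∧ p ∈ M.nfa.accept ∧ ∃ q' ∈ N.nfa.start, r = Sum.inr q')}
        | Sum.inr p => {r | ∃ p' ∈ N.nfa.step p a, r = Sum.inr p'}
      start := Sum.inl '' M.nfa.start
      accept := Sum.inr '' N.nfa.accept }

/-- ε-preserving product: letters are read synchronously, an ε-transition is done by one of the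
two components while the other one stays. -/
def inter (M N : FinNFA A) : FinNFA A where
  State := M.State × N.State
  finite := by
    have := M.finite
    have := N.finite
    infer_instance
  nfa :=
    { step := fun q a =>
        match a with
        | some c => {r | r.1 ∈ M.nfa.step q.1 (some c) ∧ r.2 ∈ N.nfa.step q.2 (some c)}
        | none => {r | (q.2 = r.2 ∧ r.1 ∈ M.nfa.step q.1 none) ∨
            (q.1 = r.1 ∧ r.2 ∈ N.nfa.step q.2 none)}
      start := M.nfa.start ×ˢ N.nfa.start
      accept := M.nfa.accept ×ˢ N.nfa.accept }

/-- The intersection automaton of the nonempty family `N, L₁, L₂, …`. -/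
def interList (N : FinNFA A) (L : List (FinNFA A)) : FinNFA A := L.foldl inter N

/-- `q` is reachable from `p`. -/
def Reach (M : FinNFA A) (p q : M.State) : Prop := ∃ w, M.nfa.IsPath p q w

/-- The state `q` belongs to some accepting run. -/
def Useful (M : FinNFA A) (q : M.State) : Prop :=
  (∃ p ∈ M.nfa.start, M.Reach p q) ∧ ∃ r ∈ M.nfa.accept, M.Reach q r

/-- Trimming: keep only the states that belong to some accepting run. -/
def trim (M : FinNFA A) : FinNFA A where
  State := {q : M.State // M.Useful q}
  finite := by
    have := M.finite
    infer_instance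
  nfa :=
    { step := fun q a => {r | r.1 ∈ M.nfa.step q.1 a}
      start := {q | q.1 ∈ M.nfa.start}
      accept := {q | q.1 ∈ M.nfa.accept} }

/-- Trimming after the initial states were replaced by `S` and the final states by `F`. -/
def segment (M : FinNFA A) (S F : Set M.State) : FinNFA A :=
  trim { State := M.State, finite := M.finite,
         nfa := { step := M.nfa.step, start := S, accept := F } }

/-- `M.CutFrom p [(q₁, r₁), …, (qₖ, rₖ)]`: some run from `p` to a final state takes the
ε-transitions `q₁ → r₁`, …, `qₖ → rₖ` in that order. -/
def CutFrom (M : FinNFA A) : M.State → List (M.State × M.State) → Prop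
  | p, [] => ∃ f ∈ M.nfa.accept, M.Reach p f
  | p, (q, r) :: c => M.Reach p q ∧ r ∈ M.nfa.step q none ∧ CutFrom M r c

/-- The tuple `c` of ε-transitions appears, in that order, in an accepting run. -/
def IsCut (M : FinNFA A) (c : List (M.State × M.State)) : Prop :=
  ∃ p ∈ M.nfa.start, M.CutFrom p c

/-- The automata between consecutive ε-transitions of the tuple, the first one starting in `S`
and the last one ending in the final states of `M`. -/
def segments (M : FinNFA A) : Set M.State → List (M.State × M.State) → List (FinNFA A)
  | S, [] => [M.segment S M.nfa.accept]
  | S, (q, r) :: c => M.segment S {q} :: segments M {r} c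

/-- `noodlify`: the noodles of `M` with `n` parts, one for each `(n-1)`-tuple of ε-transitions
that appear, in that order, in an accepting run of `M`. The first part starts in the initial states
of `M` and the last one ends in the final states of `M`. For `n = 0` (empty left-hand side) the
only possible tuple is the empty one, and no part belongs to a variable. -/
def noodlify (M : FinNFA A) (n : ℕ) : Set (List (FinNFA A)) :=
  {N | ∃ c : List (M.State × M.State), c.length = n - 1 ∧ M.IsCut c ∧
    N = M.segments M.nfa.start c}

end FinNFA

/-! ### Automata assignments and the refinement step -/

/-- An automata assignment maps every string variable to an automaton. -/
abbrev AutAssign (A X : Type*) := X → FinNFA A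

namespace AutAssign

variable {A X : Type*}

/-- The automaton of a term: the ε-concatenation of the automata of its variables. -/
def term (aut : AutAssign A X) : List X → FinNFA A
  | [] => FinNFA.unit A
  | [x] => aut x
  | x :: y :: t => (aut x).concat (term aut (y :: t))

/-- All assigned languages are nonempty. -/
def Feasible (aut : AutAssign A X) : Prop := ∀ x, ∃ w, w ∈ (aut x).lang

open Classical in
/-- The automata assignment obtained from a noodle `N` for the term `s`: a variable of `s` gets
the intersection of the parts of `N` at its occurrences in `s`, other variables are unchanged. -/
noncomputable def unify (aut : AutAssign A X) (s : List X) (N : List (FinNFA A)) :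
    AutAssign A X := fun x =>
  match (s.zip N).filterMap (fun p => if p.1 = x then some p.2 else none) with
  | [] => aut x
  | M :: L => FinNFA.interList M L

/-- `refine` for the inclusion `s ⊆ t`: one assignment for each noodle of the product of the
automaton of `s` with the minimised automaton of `t`, except those making `s` empty. -/
def refine (minimise : FinNFA A → FinNFA A) (aut : AutAssign A X) (s t : List X) :
    Set (AutAssign A X) :=
  {aut' | ∃ N ∈ ((aut.term s).inter (minimise (aut.term t))).noodlify s.length,
    aut' = aut.unify s N ∧ ∃ w, w ∈ (aut'.term s).lang}

end AutAssign

/-- What the algorithm needs from a size reduction method: the result has no ε-transitions and the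
same language. Any such map is allowed, in particular every actual reduction. -/
def IsReduction {A : Type*} (minimise : FinNFA A → FinNFA A) : Prop :=
  ∀ M, (minimise M).EpsFree ∧ (minimise M).lang = M.lang

/-! ### Systems of word equations and inclusion graphs -/

/-- A conjunction of `m` word equations, each between two different terms, and no two of them
equal up to swapping the sides. -/
structure EqSystem (X : Type*) where
  m : ℕ
  left : Fin m → List X
  right : Fin m → List X
  ne : ∀ i, left i ≠ right i
  distinct : Function.Injective fun i => s(left i, right i)

namespace EqSystem

variable {A X : Type*}

/-- A side of an equation; `true` is the left side, `false` the right side. The side `v` also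
stands for the inclusion of that side of the equation in the other side. -/
abbrev Node (Φ : EqSystem X) := Fin Φ.m × Bool

variable (Φ : EqSystem X)

/-- The other side of the equation, and the dual inclusion. -/
def dual (v : Φ.Node) : Φ.Node := (v.1, !v.2)

/-- The term on the left of the inclusion `v`. -/
def lhs (v : Φ.Node) : List X := if v.2 then Φ.left v.1 else Φ.right v.1

/-- The term on the right of the inclusion `v`. -/
def rhs (v : Φ.Node) : List X := Φ.lhs (Φ.dual v)

/-- `ν` solves all equations. -/
def Solves (ν : X → List A) : Prop :=
  ∀ i, (Φ.left i).flatMap ν = (Φ.right i).flatMap ν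

/-- The equations together with the regular constraints `x ∈ L(aut x)` have a solution. -/
def Satisfiable (aut : AutAssign A X) : Prop :=
  ∃ ν : X → List A, Φ.Solves ν ∧ ∀ x, ν x ∈ (aut x).lang

/-- Edges of the simplified splitting graph on all inclusions `s ⊆ t`: there is an edge from
`s ⊆ t` to `s' ⊆ t'` if `s` and `t'` have different occurrences of the same variable, an occurrence
being a position in a side of an equation. -/
def SplitEdge (v w : Φ.Node) : Prop :=
  ∃ (x : X) (k l : ℕ), (Φ.lhs v)[k]? = some x ∧ (Φ.rhs w)[l]? = some x ∧ (v, k) ≠ (Φ.dual w, l)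

/-- The simplified splitting graph has no cycle. -/
def ChainFree : Prop := ∀ v, ¬ Relation.TransGen Φ.SplitEdge v v

/-- A directed graph on a set of inclusions. -/
structure Graph (Φ : EqSystem X) where
  V : Finset Φ.Node
  E : Φ.Node → Φ.Node → Prop

/-- The graph has no cycle (a loop is a cycle). -/
def Graph.Acyclic {Φ : EqSystem X} (G : Φ.Graph) : Prop := ∀ v, ¬ Relation.TransGen G.E v v

/-- Inclusion graphs. -/
structure IsInclusionGraph (G : Φ.Graph) : Prop where
  atLeastOne : ∀ v, v ∈ G.V ∨ Φ.dual v ∈ G.V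
  multiOccur : ∀ v ∈ G.V,
    (∃ x ∈ Φ.rhs v, ∃ u ∈ G.V, ∃ w ∈ G.V, ∃ k l : ℕ, (u, k) ≠ (w, l) ∧
      (Φ.rhs u)[k]? = some x ∧ (Φ.rhs w)[l]? = some x) → Φ.dual v ∈ G.V
  edges : ∀ v w, G.E v w ↔ v ∈ G.V ∧ w ∈ G.V ∧ ∃ x, x ∈ Φ.lhs v ∧ x ∈ Φ.rhs w
  cycle : ∀ v ∈ G.V, Relation.TransGen G.E v v → Φ.dual v ∈ G.V

/-- The graph with vertices `V` and with an edge from `s ⊆ t` to `s' ⊆ t'` whenever `s` and `t'`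
share a variable. -/
def graphOn (V : Finset Φ.Node) : Φ.Graph where
  V := V
  E := fun v w => v ∈ V ∧ w ∈ V ∧ ∃ x, x ∈ Φ.lhs v ∧ x ∈ Φ.rhs w

/-! ### The algorithms as transition systems -/

/-- In the splitting graph restricted to `R`, the vertex `v` alone is a strongly connected
component without edges (no loop), and no edge comes from outside. -/
def TrivialSource (R : Finset Φ.Node) (v : Φ.Node) : Prop :=
  v ∈ R ∧ ¬ Φ.SplitEdge v v ∧ ∀ u ∈ R, u ≠ v → ¬ Φ.SplitEdge u v

/-- One iteration of the loop of `incl`; a state consists of the remaining nodes of the splitting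
graph and of the nodes chosen so far. -/
def InclStep (p q : Finset Φ.Node × Finset Φ.Node) : Prop :=
  ∃ v, Φ.TrivialSource p.1 v ∧ q = (p.1 \ {v, Φ.dual v}, p.2 ∪ {v})

/-- Initial state of `incl`. -/
def inclInit : Finset Φ.Node × Finset Φ.Node := (Finset.univ, ∅)

/-- Some execution of `incl` returns the graph `G`. -/
def InclReturns (G : Φ.Graph) : Prop :=
  ∃ R V', Relation.ReflTransGen Φ.InclStep Φ.inclInit (R, V') ∧
    (∀ v, ¬ Φ.TrivialSource R v) ∧ G = Φ.graphOn (V' ∪ R)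

/-- States of `propagate`: the queue of branches, or a returned answer. A branch is an automata
assignment with its queue of nodes. -/
inductive PState (A : Type*) {X : Type*} (Φ : EqSystem X)
  | running (queue : List (AutAssign A X × List Φ.Node))
  | sat
  | unsat

variable {Φ}

/-- One iteration of the loop of `propagate` on the graph `G`. The queues are first-in first-out;
the order in which the elements of a set are enqueued is arbitrary. -/
inductive PropagateStep (minimise : FinNFA A → FinNFA A) (G : Φ.Graph) :
    PState A Φ → PState A Φ → Prop
  | returnUnsat : PropagateStep minimise G (.running []) .unsat
  | returnSat (aut : AutAssign A X) (Q : List (AutAssign A X × List Φ.Node)) :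
      PropagateStep minimise G (.running ((aut, []) :: Q)) .sat
  | skip (aut : AutAssign A X) (v : Φ.Node) (W : List Φ.Node)
      (Q : List (AutAssign A X × List Φ.Node))
      (h : (aut.term (Φ.lhs v)).lang ≤ (aut.term (Φ.rhs v)).lang) :
      PropagateStep minimise G (.running ((aut, v :: W) :: Q)) (.running (Q ++ [(aut, W)]))
  | refine (aut : AutAssign A X) (v : Φ.Node) (W : List Φ.Node)
      (Q : List (AutAssign A X × List Φ.Node))
      (h : ¬ (aut.term (Φ.lhs v)).lang ≤ (aut.term (Φ.rhs v)).lang)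
      (T : List (AutAssign A X)) (hTnodup : T.Nodup)
      (hT : ∀ aut', aut' ∈ T ↔ aut' ∈ aut.refine minimise (Φ.lhs v) (Φ.rhs v))
      (U : List Φ.Node) (hUnodup : U.Nodup) (hU : ∀ u, u ∈ U ↔ G.E v u ∧ u ∉ W) :
      PropagateStep minimise G (.running ((aut, v :: W) :: Q))
        (.running (Q ++ T.map fun aut' => (aut', W ++ U)))

/-- `order` lists the vertices of the graph, each one once. -/
def Graph.Enumerates (G : Φ.Graph) (order : List Φ.Node) : Prop :=
  order.Nodup ∧ ∀ v, v ∈ order ↔ v ∈ G.V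

/-- Initial state of `propagate`, the vertices being enqueued in the given order. -/
def propagateInit (aut : AutAssign A X) (order : List Φ.Node) : PState A Φ :=
  .running [(aut, order)]

end EqSystem

/-- Every execution from `s` is finite, and it can only stop in a state that satisfies `Final`. -/
def Terminates {S : Type*} (Step : S → S → Prop) (Final : S → Prop) (s : S) : Prop :=
  (¬ ∃ f : ℕ → S, f 0 = s ∧ ∀ n, Step (f n) (f (n + 1))) ∧
    ∀ s', Relation.ReflTransGen Step s s' → (∀ s'', ¬ Step s' s'') → Final s'

namespace EqSystem

variable {A X : Type*} {Φ : EqSystem X}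

/-- `propagate` terminates with an answer on the graph `G` and the initial assignment `aut`,
whatever order is used for its vertices and in its queues. -/
def PropagateTerminates (minimise : FinNFA A → FinNFA A) (G : Φ.Graph) (aut : AutAssign A X) :
    Prop :=
  ∀ order, G.Enumerates order →
    Terminates (PropagateStep minimise G) (fun p => p = .sat ∨ p = .unsat)
      (propagateInit aut order)

/-- Some execution of `propagate` on `G` and `aut` returns the answer `p`. -/
def PropagateReturns (minimise : FinNFA A → FinNFA A) (G : Φ.Graph) (aut : AutAssign A X)
    (p : PState A Φ) : Prop :=
  ∃ order, G.Enumerates order ∧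
    Relation.ReflTransGen (PropagateStep minimise G) (propagateInit aut order) p

/-- `incl` terminates: it has no infinite execution. -/
def InclTerminates (Φ : EqSystem X) : Prop :=
  ¬ ∃ f : ℕ → Finset Φ.Node × Finset Φ.Node, f 0 = Φ.inclInit ∧
    ∀ n, Φ.InclStep (f n) (f (n + 1))

end EqSystem

/-!
The proof has three independent parts.

*Termination.* A refinement for `v` replaces `v` in the node queue of a branch by successors of `v`,
and the branch by finitely many branches. On an acyclic graph the passage to successors is
well-founded, hence so is the relation `Relation.CutExpand` between multisets of nodes, and hence so
is `Relation.CutExpand` between multisets of such multisets; by `PropagateStep.cutExpand` every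
iteration of `propagate` decreases the multiset of node queues.

*Correctness of one refinement.* `Splits` describes a run that is cut into pieces by a list of
ε-transitions. If `ν` solves the constraints, an accepting run of the product on the value of `s`
can be cut at the borders between the variables of `s`, and the noodle of this cut keeps `ν`
(`AutAssign.exists_mem_refine`); so `unsat` is never returned for a satisfiable system. Conversely,
as all automata stay ε-free, an accepting run of the automaton of a term with `n` variables has
exactly `n - 1` ε-transitions, one at each border, so that the parts of a noodle are ε-free and
accept only words of the languages of their variables (`AutAssign.epsFree_of_mem_refine`,
`AutAssign.lang_le_of_mem_refine`). Together with `AutAssign.lang_term_le_of_mem_refine` this shows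
that a branch with an empty queue satisfies all inclusions of the graph (`GoodBranch`).

*Chain-free systems.* In an acyclic splitting graph there is always a source, so `incl` removes all
nodes. The chosen inclusions contain exactly one of each dual pair, and no variable has two
occurrences on their right-hand sides (`InclInv`): otherwise the inclusion that was chosen first
would have had an incoming edge from the dual of the other one. The
edges between the chosen inclusions are edges of the splitting graph, which gives acyclicity. If now
all chosen inclusions hold for the languages, they can be made true by a choice of words one after
the other, each one after its successors (`exists_solution_of_stable`).
-/

/-! ### Runs of automata -/

namespace FinNFA

variable {A : Type*}

/-- `M.Run p q w`: some run from `p` to `q` reads the word `w`; ε-transitions read nothing. -/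
inductive Run (M : FinNFA A) : M.State → M.State → List A → Prop
  | refl (p) : Run M p p []
  | eps {p q r w} : q ∈ M.nfa.step p none → Run M q r w → Run M p r w
  | letter {p q r w} (a : A) : q ∈ M.nfa.step p (some a) → Run M q r w → Run M p r (a :: w)

variable {M N : FinNFA A}

theorem Run.trans {p q r : M.State} {u v : List A} (h : M.Run p q u) (h' : M.Run q r v) :
    M.Run p r (u ++ v) := by
  induction h with
  | refl => exact h'
  | eps hs _ ih => exact .eps hs (ih h')
  | letter a hs _ ih => exact .letter a hs (ih h')

theorem run_append_iff {p r : M.State} {u v : List A} :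
    M.Run p r (u ++ v) ↔ ∃ q, M.Run p q u ∧ M.Run q r v := by
  refine ⟨fun h => ?_, fun ⟨q, h, h'⟩ => h.trans h'⟩
  generalize hw : u ++ v = w at h
  induction h generalizing u with
  | refl p =>
    obtain ⟨rfl, rfl⟩ := List.append_eq_nil_iff.1 hw
    exact ⟨p, .refl p, .refl p⟩
  | eps hs _ ih =>
    obtain ⟨q, h₁, h₂⟩ := ih hw
    exact ⟨q, .eps hs h₁, h₂⟩
  | @letter p _ _ _ a hs h ih =>
    cases u with
    | nil =>
      obtain rfl : v = _ := hw
      exact ⟨p, .refl p, .letter a hs h⟩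
    | cons b u =>
      obtain ⟨rfl, hw'⟩ := List.cons.inj hw
      obtain ⟨q, h₁, h₂⟩ := ih hw'
      exact ⟨q, .letter b hs h₁, h₂⟩

theorem run_iff_isPath {p q : M.State} {w : List A} :
    M.Run p q w ↔ ∃ x : List (Option A), x.reduceOption = w ∧ M.nfa.IsPath p q x := by
  constructor
  · intro h
    induction h with
    | refl p => exact ⟨[], rfl, .nil p⟩
    | eps hs _ ih =>
      obtain ⟨x, hx, h⟩ := ih
      exact ⟨none :: x, by simpa using hx, .cons _ _ _ _ _ hs h⟩
    | letter a hs _ ih =>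
      obtain ⟨x, rfl, h⟩ := ih
      exact ⟨some a :: x, by simp, .cons _ _ _ _ _ hs h⟩
  · rintro ⟨x, rfl, h⟩
    induction h with
    | nil p => exact .refl p
    | cons t s u a x hs _ ih =>
      cases a with
      | none => simpa using Run.eps hs ih
      | some a => simpa using Run.letter a hs ih

theorem reach_iff {p q : M.State} : M.Reach p q ↔ ∃ w, M.Run p q w := by
  simp only [run_iff_isPath]
  exact ⟨fun ⟨x, h⟩ => ⟨_, x, rfl, h⟩, fun ⟨_, x, _, h⟩ => ⟨x, h⟩⟩

theorem mem_lang_iff {w : List A} :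
    w ∈ M.lang ↔ ∃ p ∈ M.nfa.start, ∃ q ∈ M.nfa.accept, M.Run p q w := by
  simp only [run_iff_isPath]
  rw [lang, εNFA.mem_accepts_iff_exists_path]
  constructor
  · rintro ⟨p, q, x, hp, hq, hx, h⟩
    exact ⟨p, hp, q, hq, x, hx, h⟩
  · rintro ⟨p, hp, q, hq, x, hx, h⟩
    exact ⟨p, q, x, hp, hq, hx, h⟩

theorem mem_lang_unit {w : List A} : w ∈ (unit A).lang ↔ w = [] := by
  rw [mem_lang_iff]
  constructor
  · rintro ⟨p, -, q, -, h⟩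
    cases h with
    | refl => rfl
    | eps hs _ => exact hs.elim
    | letter a hs _ => exact hs.elim
  · rintro rfl
    exact ⟨(), trivial, (), trivial, .refl _⟩

/-! ### Concatenation, intersection and trimming -/

theorem concat_run_inr {p : N.State} {x : (M.concat N).State} {w : List A} :
    (M.concat N).Run (Sum.inr p) x w ↔ ∃ q, x = Sum.inr q ∧ N.Run p q w := by
  constructor
  · suffices key : ∀ {s x : (M.concat N).State} {w}, (M.concat N).Run s x w → ∀ {p},
        Sum.inr p = s → ∃ q, x = Sum.inr q ∧ N.Run p q w from fun h => key h rfl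
    clear p x w
    intro s x w h p hs
    induction h generalizing p with
    | refl => exact ⟨p, hs.symm, .refl p⟩
    | eps h _ ih =>
      subst hs
      obtain ⟨p', h, rfl⟩ := h
      obtain ⟨q, rfl, h'⟩ := ih rfl
      exact ⟨q, rfl, .eps h h'⟩
    | letter a h _ ih =>
      subst hs
      obtain ⟨p', h, rfl⟩ := h
      obtain ⟨q, rfl, h'⟩ := ih rfl
      exact ⟨q, rfl, .letter a h h'⟩
  · rintro ⟨q, rfl, h⟩
    induction h with
    | refl p => exact .refl _
    | eps hs _ ih => exact .eps ⟨_, hs, rfl⟩ ih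
    | letter a hs _ ih => exact .letter a ⟨_, hs, rfl⟩ ih

theorem concat_run_inl_inl {p q : M.State} {w : List A} :
    (M.concat N).Run (Sum.inl p) (Sum.inl q) w ↔ M.Run p q w := by
  constructor
  · suffices key : ∀ {s t : (M.concat N).State} {w}, (M.concat N).Run s t w → ∀ {p q},
        Sum.inl p = s → Sum.inl q = t → M.Run p q w from fun h => key h rfl rfl
    clear p q w
    intro s t w h p q hs ht
    induction h generalizing p with
    | refl =>
      obtain rfl := Sum.inl.inj (hs.trans ht.symm)
      exact .refl p
    | eps h h' ih =>
      subst hs ht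
      obtain ⟨p', h, rfl⟩ | ⟨-, -, q', -, rfl⟩ := h
      · exact .eps h (ih rfl rfl)
      · obtain ⟨_, h, -⟩ := concat_run_inr.1 h'
        exact (Sum.inl_ne_inr h).elim
    | letter a h h' ih =>
      subst hs ht
      obtain ⟨p', h, rfl⟩ | ⟨h, -⟩ := h
      · exact .letter a h (ih rfl rfl)
      · exact (Option.some_ne_none a h).elim
  · intro h
    induction h with
    | refl p => exact .refl _
    | eps hs _ ih => exact .eps (Or.inl ⟨_, hs, rfl⟩) ih
    | letter a hs _ ih => exact .letter a (Or.inl ⟨_, hs, rfl⟩) ih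

theorem concat_run_inl_inr {p : M.State} {q : N.State} {w : List A} :
    (M.concat N).Run (Sum.inl p) (Sum.inr q) w ↔
      ∃ f ∈ M.nfa.accept, ∃ s ∈ N.nfa.start, ∃ u v, w = u ++ v ∧ M.Run p f u ∧ N.Run s q v := by
  constructor
  · suffices key : ∀ {s t : (M.concat N).State} {w}, (M.concat N).Run s t w → ∀ {p q},
        Sum.inl p = s → Sum.inr q = t → ∃ f ∈ M.nfa.accept, ∃ s ∈ N.nfa.start,
          ∃ u v, w = u ++ v ∧ M.Run p f u ∧ N.Run s q v from fun h => key h rfl rfl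
    clear p q w
    intro s t w h p q hs ht
    induction h generalizing p with
    | refl => exact (Sum.inl_ne_inr (hs.trans ht.symm)).elim
    | eps h h' ih =>
      subst hs ht
      obtain ⟨p', h, rfl⟩ | ⟨-, hp, q', hq', rfl⟩ := h
      · obtain ⟨f, hf, s, hs, u, v, rfl, h₁, h₂⟩ := ih rfl rfl
        exact ⟨f, hf, s, hs, u, v, rfl, .eps h h₁, h₂⟩
      · obtain ⟨_, h, h''⟩ := concat_run_inr.1 h'
        obtain rfl := Sum.inr.inj h
        exact ⟨p, hp, q', hq', [], _, rfl, .refl p, h''⟩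
    | letter a h h' ih =>
      subst hs ht
      obtain ⟨p', h, rfl⟩ | ⟨h, -⟩ := h
      · obtain ⟨f, hf, s, hs, u, v, rfl, h₁, h₂⟩ := ih rfl rfl
        exact ⟨f, hf, s, hs, a :: u, v, rfl, .letter a h h₁, h₂⟩
      · exact (Option.some_ne_none a h).elim
  · rintro ⟨f, hf, s, hs, u, v, rfl, h₁, h₂⟩
    exact (concat_run_inl_inl.2 h₁).trans
      (.eps (Or.inr ⟨rfl, hf, s, hs, rfl⟩) (concat_run_inr.2 ⟨q, rfl, h₂⟩))

theorem mem_lang_concat {w : List A} :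
    w ∈ (M.concat N).lang ↔ ∃ u ∈ M.lang, ∃ v ∈ N.lang, w = u ++ v := by
  simp only [mem_lang_iff]
  constructor
  · rintro ⟨_, ⟨p, hp, rfl⟩, _, ⟨q, hq, rfl⟩, h⟩
    obtain ⟨f, hf, s, hs, u, v, rfl, h₁, h₂⟩ := concat_run_inl_inr.1 h
    exact ⟨u, ⟨p, hp, f, hf, h₁⟩, v, ⟨s, hs, q, hq, h₂⟩, rfl⟩
  · rintro ⟨u, ⟨p, hp, f, hf, h₁⟩, v, ⟨s, hs, q, hq, h₂⟩, rfl⟩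
    exact ⟨_, ⟨p, hp, rfl⟩, _, ⟨q, hq, rfl⟩,
      concat_run_inl_inr.2 ⟨f, hf, s, hs, u, v, rfl, h₁, h₂⟩⟩

theorem inter_run_iff {p q : (M.inter N).State} {w : List A} :
    (M.inter N).Run p q w ↔ M.Run p.1 q.1 w ∧ N.Run p.2 q.2 w := by
  constructor
  · intro h
    induction h with
    | refl p => exact ⟨.refl _, .refl _⟩
    | eps hs _ ih =>
      obtain ⟨e, h⟩ | ⟨e, h⟩ := hs
      · exact ⟨.eps h ih.1, e ▸ ih.2⟩
      · exact ⟨e ▸ ih.1, .eps h ih.2⟩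
    | letter a hs _ ih => exact ⟨.letter a hs.1 ih.1, .letter a hs.2 ih.2⟩
  · obtain ⟨p₁, p₂⟩ := p
    obtain ⟨q₁, q₂⟩ := q
    rintro ⟨h₁, h₂⟩
    dsimp only at h₁ h₂
    induction h₁ generalizing p₂ with
    | refl p =>
      generalize hw : ([] : List A) = w at h₂
      induction h₂ with
      | refl => exact .refl _
      | @eps _ p' _ _ hs _ ih =>
        exact .eps (q := ((p, p') : (M.inter N).State)) (Or.inr ⟨rfl, hs⟩) (ih hw)
      | letter => cases hw
    | @eps _ p' _ _ hs _ ih =>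
      exact .eps (q := ((p', p₂) : (M.inter N).State)) (Or.inl ⟨rfl, hs⟩) (ih _ h₂)
    | @letter p _ _ w a hs _ ih =>
      -- the second component first performs the ε-transitions that precede the letter `a`
      generalize hw : a :: w = w' at h₂
      induction h₂ with
      | refl => cases hw
      | @eps _ p' _ _ hs' _ ih' =>
        exact .eps (q := ((p, p') : (M.inter N).State)) (Or.inr ⟨rfl, hs'⟩) (ih' ih hw)
      | letter b hs' h' _ =>
        obtain ⟨rfl, rfl⟩ := List.cons.inj hw
        exact .letter a ⟨hs, hs'⟩ (ih _ h')

theorem mem_lang_inter {w : List A} : w ∈ (M.inter N).lang ↔ w ∈ M.lang ∧ w ∈ N.lang := by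
  simp only [mem_lang_iff]
  constructor
  · rintro ⟨p, hp, q, hq, h⟩
    obtain ⟨h₁, h₂⟩ := inter_run_iff.1 h
    exact ⟨⟨_, hp.1, _, hq.1, h₁⟩, ⟨_, hp.2, _, hq.2, h₂⟩⟩
  · rintro ⟨⟨p₁, hp₁, q₁, hq₁, h₁⟩, ⟨p₂, hp₂, q₂, hq₂, h₂⟩⟩
    exact ⟨(p₁, p₂), ⟨hp₁, hp₂⟩, (q₁, q₂), ⟨hq₁, hq₂⟩, inter_run_iff.2 ⟨h₁, h₂⟩⟩

theorem EpsFree.inter (hM : M.EpsFree) (hN : N.EpsFree) : (M.inter N).EpsFree := by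
  intro q
  refine Set.eq_empty_iff_forall_notMem.2 fun r hr => ?_
  obtain ⟨-, h⟩ | ⟨-, h⟩ := hr
  · rw [hM] at h
    exact h
  · rw [hN] at h
    exact h

theorem mem_lang_interList {L : List (FinNFA A)} {w : List A} :
    w ∈ (interList N L).lang ↔ ∀ K ∈ N :: L, w ∈ K.lang := by
  induction L generalizing N with
  | nil => simp [interList]
  | cons K L ih =>
    have := @ih (N.inter K)
    simp only [List.forall_mem_cons, mem_lang_inter, and_assoc] at this ⊢
    exact this

theorem epsFree_interList {L : List (FinNFA A)} (h : ∀ K ∈ N :: L, K.EpsFree) :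
    (interList N L).EpsFree := by
  induction L generalizing N with
  | nil => exact h N (by simp)
  | cons K L ih =>
    simp only [List.forall_mem_cons] at h
    refine ih (N := N.inter K) ?_
    simp only [List.forall_mem_cons]
    exact ⟨h.1.inter h.2.1, h.2.2⟩

theorem trim_run_iff {p q : M.trim.State} {w : List A} :
    M.trim.Run p q w ↔ M.Run p.1 q.1 w := by
  constructor
  · intro h
    induction h with
    | refl => exact .refl _
    | eps hs _ ih => exact .eps hs ih
    | letter a hs _ ih => exact .letter a hs ih
  · obtain ⟨p, hp⟩ := p
    obtain ⟨q, hq⟩ := q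
    intro h
    dsimp only at h
    -- a state between two useful states is useful
    have key : ∀ {p p' : M.State} {a}, M.Useful p → M.Useful q → p' ∈ M.nfa.step p a →
        ∀ {w}, M.Run p' q w → M.Useful p' := by
      rintro p p' a ⟨⟨s, hs, x, hx⟩, -⟩ ⟨-, f, hf, y, hy⟩ hstep w h
      obtain ⟨z, -, hz⟩ := run_iff_isPath.1 h
      exact ⟨⟨s, hs, x ++ [a], M.nfa.isPath_append.2 ⟨p, hx, by simpa using hstep⟩⟩,
        f, hf, z ++ y, M.nfa.isPath_append.2 ⟨q, hz, hy⟩⟩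
    induction h with
    | refl => exact .refl _
    | eps hs h ih =>
      have hu := key hp hq hs h
      exact .eps (q := (⟨_, hu⟩ : M.trim.State)) hs (ih hu hq key)
    | letter a hs h ih =>
      have hu := key hp hq hs h
      exact .letter (q := (⟨_, hu⟩ : M.trim.State)) a hs (ih hu hq key)

theorem mem_lang_trim {w : List A} : w ∈ M.trim.lang ↔ w ∈ M.lang := by
  simp only [mem_lang_iff]
  constructor
  · rintro ⟨p, hp, q, hq, h⟩
    exact ⟨p.1, hp, q.1, hq, trim_run_iff.1 h⟩
  · rintro ⟨p, hp, q, hq, h⟩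
    have hr : M.Reach p q := reach_iff.2 ⟨w, h⟩
    have hself : ∀ r : M.State, M.Reach r r := fun r => ⟨[], .nil r⟩
    exact ⟨⟨p, ⟨p, hp, hself p⟩, q, hq, hr⟩, hp, ⟨q, ⟨p, hp, hr⟩, q, hq, hself q⟩, hq,
      trim_run_iff.2 h⟩

/-- The automaton `M` with initial states `S` and final states `F`; a segment is its trimming. -/
def between (M : FinNFA A) (S F : Set M.State) : FinNFA A where
  State := M.State
  finite := M.finite
  nfa := { step := M.nfa.step, start := S, accept := F }

theorem between_run_iff {S F : Set M.State} {p q : M.State} {w : List A} :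
    (M.between S F).Run p q w ↔ M.Run p q w := by
  constructor
  · suffices key : ∀ {p q : (M.between S F).State} {w}, (M.between S F).Run p q w →
        M.Run p q w from fun h => key h
    intro p q w h
    induction h with
    | refl => exact .refl _
    | eps hs _ ih => exact .eps hs ih
    | letter a hs _ ih => exact .letter a hs ih
  · intro h
    induction h with
    | refl p => exact .refl (M := M.between S F) p
    | eps hs _ ih => exact .eps (M := M.between S F) hs ih
    | letter a hs _ ih => exact .letter (M := M.between S F) a hs ih

theorem mem_lang_segment {S F : Set M.State} {w : List A} :
    w ∈ (M.segment S F).lang ↔ ∃ p ∈ S, ∃ q ∈ F, M.Run p q w := by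
  rw [show M.segment S F = (M.between S F).trim from rfl, mem_lang_trim, mem_lang_iff]
  constructor
  · rintro ⟨p, hp, q, hq, h⟩
    exact ⟨p, hp, q, hq, between_run_iff.1 h⟩
  · rintro ⟨p, hp, q, hq, h⟩
    exact ⟨p, hp, q, hq, between_run_iff.2 h⟩

theorem exists_eps_of_not_epsFree_segment {S F : Set M.State} (h : ¬ (M.segment S F).EpsFree) :
    ∃ p ∈ S, ∃ f ∈ F, ∃ q r, M.Reach p q ∧ r ∈ M.nfa.step q none ∧ M.Reach r f := by
  obtain ⟨q, hq⟩ := not_forall.1 h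
  obtain ⟨r, hr⟩ := Set.nonempty_iff_ne_empty.2 hq
  obtain ⟨⟨p, hp, hpq⟩, -⟩ := q.2
  obtain ⟨-, f, hf, hrf⟩ := r.2
  refine ⟨p, hp, f, hf, q.1, r.1, ?_, hr, ?_⟩
  · obtain ⟨w, hw⟩ := reach_iff.1 hpq
    exact reach_iff.2 ⟨w, between_run_iff.1 hw⟩
  · obtain ⟨w, hw⟩ := reach_iff.1 hrf
    exact reach_iff.2 ⟨w, between_run_iff.1 hw⟩

end FinNFA

/-! ### Runs cut at ε-transitions -/

namespace FinNFA

variable {A : Type*} {M N : FinNFA A}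

/-- `M.Splits p [(q₁, r₁), …, (qₖ, rₖ)] [w₀, …, wₖ]`: some run from `p` to a final state takes the
ε-transitions `qᵢ → rᵢ` in that order, and these cut the word it reads into `w₀, …, wₖ`. -/
def Splits (M : FinNFA A) : M.State → List (M.State × M.State) → List (List A) → Prop
  | p, [], ws => ∃ w, ws = [w] ∧ ∃ f ∈ M.nfa.accept, M.Run p f w
  | p, (q, r) :: c, ws =>
      ∃ w ws', ws = w :: ws' ∧ M.Run p q w ∧ r ∈ M.nfa.step q none ∧ M.Splits r c ws'

theorem cutFrom_iff {p : M.State} {c : List (M.State × M.State)} :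
    M.CutFrom p c ↔ ∃ ws, M.Splits p c ws := by
  induction c generalizing p with
  | nil =>
    simp only [CutFrom, Splits, reach_iff]
    constructor
    · rintro ⟨f, hf, w, h⟩
      exact ⟨[w], w, rfl, f, hf, h⟩
    · rintro ⟨_, w, -, f, hf, h⟩
      exact ⟨f, hf, w, h⟩
  | cons e c ih =>
    obtain ⟨q, r⟩ := e
    simp only [CutFrom, Splits, reach_iff, ih]
    constructor
    · rintro ⟨⟨w, h⟩, hs, ws, hc⟩
      exact ⟨w :: ws, w, ws, rfl, h, hs, hc⟩
    · rintro ⟨_, w, ws, -, h, hs, hc⟩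
      exact ⟨⟨w, h⟩, hs, ws, hc⟩

theorem Splits.run {p : M.State} {c : List (M.State × M.State)} {ws : List (List A)}
    (h : M.Splits p c ws) : ∃ f ∈ M.nfa.accept, M.Run p f ws.flatten := by
  induction c generalizing p ws with
  | nil =>
    obtain ⟨w, rfl, f, hf, h⟩ := h
    exact ⟨f, hf, by simpa using h⟩
  | cons e c ih =>
    obtain ⟨w, ws, rfl, h, hs, hc⟩ := h
    obtain ⟨f, hf, h'⟩ := ih hc
    exact ⟨f, hf, by simpa using h.trans (.eps hs h')⟩

theorem Splits.forall₂_segments {p : M.State} {S : Set M.State} {c : List (M.State × M.State)}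
    {ws : List (List A)} (h : M.Splits p c ws) (hp : p ∈ S) :
    List.Forall₂ (fun w K => w ∈ lang K) ws (M.segments S c) := by
  induction c generalizing p S ws with
  | nil =>
    obtain ⟨w, rfl, f, hf, h⟩ := h
    exact .cons (mem_lang_segment.2 ⟨p, hp, f, hf, h⟩) .nil
  | cons e c ih =>
    obtain ⟨w, ws, rfl, h, -, hc⟩ := h
    exact .cons (mem_lang_segment.2 ⟨p, hp, e.1, rfl, h⟩) (ih hc rfl)

theorem CutFrom.exists_splits {p : M.State} {S : Set M.State} {c : List (M.State × M.State)}
    {ws : List (List A)} (h : M.CutFrom p c)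
    (hws : List.Forall₂ (fun w K => w ∈ lang K) ws (M.segments S c)) :
    ∃ p' ∈ S, M.Splits p' c ws := by
  induction c generalizing p S ws with
  | nil =>
    obtain _ | ⟨hw, _ | _⟩ := hws
    obtain ⟨p', hp', f, hf, h'⟩ := mem_lang_segment.1 hw
    exact ⟨p', hp', _, rfl, f, hf, h'⟩
  | cons e c ih =>
    obtain ⟨-, hs, hc⟩ := h
    obtain _ | ⟨hw, hws⟩ := hws
    obtain ⟨p', hp', f, rfl, h'⟩ := mem_lang_segment.1 hw
    obtain ⟨r, rfl, hc'⟩ := ih hc hws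
    exact ⟨p', hp', _, _, rfl, h', hs, hc'⟩

theorem length_segments (S : Set M.State) (c : List (M.State × M.State)) :
    (M.segments S c).length = c.length + 1 := by
  induction c generalizing S with
  | nil => rfl
  | cons e c ih => simp [segments, ih]

theorem CutFrom.exists_longer {p : M.State} {S : Set M.State} {c : List (M.State × M.State)}
    {K : FinNFA A} (h : M.CutFrom p c) (hp : p ∈ S) (hK : K ∈ M.segments S c) (hK' : ¬ K.EpsFree) :
    ∃ p' ∈ S, ∃ c', c'.length = c.length + 1 ∧ M.CutFrom p' c' := by
  induction c generalizing p S with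
  | nil =>
    obtain rfl := List.mem_singleton.1 hK
    obtain ⟨p', hp', f, hf, q, r, h₁, h₂, h₃⟩ := exists_eps_of_not_epsFree_segment hK'
    exact ⟨p', hp', [(q, r)], rfl, h₁, h₂, f, hf, h₃⟩
  | cons e c ih =>
    obtain ⟨hpq, hs, hc⟩ := h
    obtain rfl | hK := List.mem_cons.1 hK
    · obtain ⟨p', hp', f, rfl, q, r, h₁, h₂, h₃⟩ := exists_eps_of_not_epsFree_segment hK'
      exact ⟨p', hp', (q, r) :: e :: c, by simp, h₁, h₂, h₃, hs, hc⟩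
    · obtain ⟨_, rfl, c', hlen, hc'⟩ := ih (S := {e.2}) hc rfl hK
      exact ⟨p, hp, e :: c', by simp [hlen], hpq, hs, hc'⟩

theorem Splits.inter_of_run {p : M.State} {c : List (M.State × M.State)} {ws : List (List A)}
    (h : M.Splits p c ws) {p' f' : N.State} (hf' : f' ∈ N.nfa.accept)
    (h' : N.Run p' f' ws.flatten) :
    ∃ c', c'.length = c.length ∧
      (M.inter N).Splits ((p, p') : (M.inter N).State) c' ws := by
  induction c generalizing p p' ws with
  | nil =>
    obtain ⟨w, rfl, f, hf, h⟩ := h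
    exact ⟨[], rfl, w, rfl, (f, f'), ⟨hf, hf'⟩, inter_run_iff.2 ⟨h, by simpa using h'⟩⟩
  | cons e c ih =>
    obtain ⟨w, ws, rfl, h, hs, hc⟩ := h
    rw [List.flatten_cons] at h'
    obtain ⟨m, h₁, h₂⟩ := run_append_iff.1 h'
    obtain ⟨c', hlen, hc'⟩ := ih hc h₂
    exact ⟨((e.1, m), (e.2, m)) :: c', by simp [hlen], w, ws, rfl, inter_run_iff.2 ⟨h, h₁⟩,
      Or.inl ⟨rfl, hs⟩, hc'⟩

/-- In the product with an ε-free automaton all ε-transitions come from the first factor. -/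
theorem Splits.fst (hN : N.EpsFree) {p : (M.inter N).State}
    {c : List ((M.inter N).State × (M.inter N).State)} {ws : List (List A)}
    (h : (M.inter N).Splits p c ws) :
    M.Splits p.1 (c.map fun e => (e.1.1, e.2.1)) ws := by
  induction c generalizing p ws with
  | nil =>
    obtain ⟨w, rfl, f, hf, h⟩ := h
    exact ⟨w, rfl, f.1, hf.1, (inter_run_iff.1 h).1⟩
  | cons e c ih =>
    obtain ⟨w, ws, rfl, h, hs, hc⟩ := h
    obtain ⟨-, hs⟩ | ⟨-, hs⟩ := hs
    · exact ⟨w, ws, rfl, (inter_run_iff.1 h).1, hs, ih hc⟩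
    · rw [hN] at hs
      exact hs.elim

theorem Splits.concat {p : N.State} {s f : M.State} {u : List A}
    {c : List (N.State × N.State)} {ws : List (List A)} (h : N.Splits p c ws)
    (hp : p ∈ N.nfa.start) (hf : f ∈ M.nfa.accept) (hu : M.Run s f u) :
    ∃ c', c'.length = c.length + 1 ∧
      (M.concat N).Splits (Sum.inl s : M.State ⊕ N.State) c' (u :: ws) := by
  have key : (M.concat N).Splits (Sum.inr p : M.State ⊕ N.State)
      (c.map fun e => (Sum.inr e.1, Sum.inr e.2)) ws := by
    clear hp hf hu
    induction c generalizing p ws with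
    | nil =>
      obtain ⟨w, rfl, f, hf, h⟩ := h
      exact ⟨w, rfl, _, ⟨f, hf, rfl⟩, concat_run_inr.2 ⟨f, rfl, h⟩⟩
    | cons e c ih =>
      obtain ⟨w, ws, rfl, h, hs, hc⟩ := h
      exact ⟨w, ws, rfl, concat_run_inr.2 ⟨_, rfl, h⟩, ⟨_, hs, rfl⟩, ih hc⟩
  exact ⟨(Sum.inl f, Sum.inr p) :: c.map fun e => (Sum.inr e.1, Sum.inr e.2), by simp,
    u, ws, rfl, concat_run_inl_inl.2 hu, Or.inr ⟨rfl, hf, p, hp, rfl⟩, key⟩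

theorem Splits.of_concat_inr {p : N.State}
    {c : List ((M.concat N).State × (M.concat N).State)} {ws : List (List A)}
    (h : (M.concat N).Splits (Sum.inr p : M.State ⊕ N.State) c ws) :
    ∃ c', c'.length = c.length ∧ N.Splits p c' ws := by
  induction c generalizing p ws with
  | nil =>
    obtain ⟨w, rfl, _, ⟨f, hf, rfl⟩, h⟩ := h
    obtain ⟨f', e, h⟩ := concat_run_inr.1 h
    obtain rfl := Sum.inr.inj e
    exact ⟨[], rfl, w, rfl, f, hf, h⟩
  | cons e c ih =>
    obtain ⟨q, r⟩ := e
    obtain ⟨w, ws, rfl, h, hs, hc⟩ := h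
    obtain ⟨q, rfl, h'⟩ := concat_run_inr.1 h
    obtain ⟨r, hs, rfl⟩ := hs
    obtain ⟨c', hlen, hc'⟩ := ih hc
    exact ⟨(q, r) :: c', by simp [hlen], w, ws, rfl, h', hs, hc'⟩

/-- A run of `M.concat N`, for an ε-free `M`, that starts in `M` and is cut at ε-transitions: the
first cut is the passage to `N`, unless the run is in `N` already before that cut. -/
theorem Splits.of_concat_inl (hM : M.EpsFree) {p : M.State}
    {e : (M.concat N).State × (M.concat N).State}
    {c : List ((M.concat N).State × (M.concat N).State)} {ws : List (List A)}
    (h : (M.concat N).Splits (Sum.inl p : M.State ⊕ N.State) (e :: c) ws) :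
    (∃ u ws', ws = u :: ws' ∧ (∃ f ∈ M.nfa.accept, M.Run p f u) ∧
        ∃ r ∈ N.nfa.start, ∃ c', c'.length = c.length ∧ N.Splits r c' ws') ∨
      ∃ r ws' c', c'.length = c.length + 1 ∧ N.Splits r c' ws' := by
  obtain ⟨q, r⟩ := e
  obtain ⟨u, ws', rfl, h, hs, hc⟩ := h
  obtain q | q := q
  · obtain ⟨r, hs, rfl⟩ | ⟨-, hq, r, hr, rfl⟩ := hs
    · rw [hM] at hs
      exact hs.elim
    · exact Or.inl ⟨u, ws', rfl, ⟨q, hq, concat_run_inl_inl.1 h⟩, r, hr, hc.of_concat_inr⟩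
  · obtain ⟨r, hs, rfl⟩ := hs
    obtain ⟨c', hlen, hc'⟩ := hc.of_concat_inr
    exact Or.inr ⟨q, [] :: ws', (q, r) :: c', by simp [hlen], _, _, rfl, .refl q, hs, hc'⟩

end FinNFA

/-! ### The automaton of a term -/

namespace AutAssign

open FinNFA

variable {A X : Type*} {aut : AutAssign A X}

theorem mem_lang_term_cons {x : X} {t : List X} {w : List A} :
    w ∈ (aut.term (x :: t)).lang ↔
      ∃ u ∈ (aut x).lang, ∃ v ∈ (aut.term t).lang, w = u ++ v := by
  cases t with
  | nil => simp [term, mem_lang_unit]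
  | cons y t => rw [term, mem_lang_concat]

theorem mem_lang_term {t : List X} {w : List A} :
    w ∈ (aut.term t).lang ↔
      ∃ ws, List.Forall₂ (fun x u => u ∈ (aut x).lang) t ws ∧ ws.flatten = w := by
  induction t generalizing w with
  | nil => simp [term, mem_lang_unit, eq_comm]
  | cons x t ih =>
    simp only [mem_lang_term_cons, ih]
    constructor
    · rintro ⟨u, hu, _, ⟨ws, hws, rfl⟩, rfl⟩
      exact ⟨u :: ws, .cons hu hws, rfl⟩
    · rintro ⟨_, _ | ⟨hu, hws⟩, rfl⟩
      exact ⟨_, hu, _, ⟨_, hws, rfl⟩, rfl⟩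

theorem flatMap_mem_lang_term {t : List X} {ν : X → List A} (h : ∀ x ∈ t, ν x ∈ (aut x).lang) :
    t.flatMap ν ∈ (aut.term t).lang := by
  refine mem_lang_term.2 ⟨t.map ν, ?_, rfl⟩
  rw [List.forall₂_map_right_iff, List.forall₂_same]
  exact h

theorem lang_term_mono {aut' : AutAssign A X} {t : List X}
    (h : ∀ x ∈ t, (aut' x).lang ≤ (aut x).lang) :
    (aut'.term t).lang ≤ (aut.term t).lang := by
  induction t with
  | nil => exact le_rfl
  | cons x t ih =>
    intro w hw
    obtain ⟨u, hu, v, hv, rfl⟩ := mem_lang_term_cons.1 hw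
    rw [List.forall_mem_cons] at h
    exact mem_lang_term_cons.2 ⟨u, h.1 hu, v, ih h.2 hv, rfl⟩

theorem exists_splits_term {x : X} {t : List X} {ws : List (List A)}
    (h : List.Forall₂ (fun x u => u ∈ (aut x).lang) (x :: t) ws) :
    ∃ p ∈ (aut.term (x :: t)).nfa.start, ∃ c, c.length = t.length ∧
      (aut.term (x :: t)).Splits p c ws := by
  induction t generalizing x ws with
  | nil =>
    obtain _ | ⟨hu, _ | _⟩ := h
    obtain ⟨p, hp, q, hq, h⟩ := mem_lang_iff.1 hu
    exact ⟨p, hp, [], rfl, _, rfl, q, hq, h⟩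
  | cons y t ih =>
    obtain _ | ⟨hu, h⟩ := h
    obtain ⟨p, hp, c, hlen, hc⟩ := ih h
    obtain ⟨s, hs, f, hf, hu⟩ := mem_lang_iff.1 hu
    obtain ⟨c', hlen', hc'⟩ := hc.concat hp hf hu
    exact ⟨_, ⟨s, hs, rfl⟩, c', hlen'.trans (by simp [hlen]), hc'⟩

/-- A run of the automaton of a term takes at most as many ε-transitions as there are borders
between the variables of the term. -/
theorem length_le_of_splits_term (haut : ∀ x, (aut x).EpsFree) {x : X} {t : List X}
    {p : (aut.term (x :: t)).State} {c ws} (h : (aut.term (x :: t)).Splits p c ws) :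
    c.length ≤ t.length := by
  induction t generalizing x ws with
  | nil =>
    cases c with
    | nil => exact le_rfl
    | cons e c =>
      obtain ⟨_, _, -, -, hs, -⟩ := h
      exact (Set.eq_empty_iff_forall_notMem.1 (haut x e.1) _ hs).elim
  | cons y t ih =>
    obtain p | p := p
    · cases c with
      | nil => simp
      | cons e c =>
        obtain ⟨_, _, -, -, r, -, c', hlen, hc⟩ | ⟨r, _, c', hlen, hc⟩ :=
          Splits.of_concat_inl (haut x) h
        · exact Nat.succ_le_succ (hlen.symm.le.trans (ih hc))
        · exact (hlen.symm.le.trans (ih hc)).trans (Nat.le_succ _)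
    · obtain ⟨c', hlen, hc⟩ := Splits.of_concat_inr h
      exact (hlen.symm.le.trans (ih hc)).trans (Nat.le_succ _)

/-- A run that takes as many ε-transitions as there are borders between the variables of the term
is cut by them exactly at these borders. -/
theorem forall₂_of_splits_term (haut : ∀ x, (aut x).EpsFree) {x : X} {t : List X}
    {p : (aut.term (x :: t)).State} {c ws} (hp : p ∈ (aut.term (x :: t)).nfa.start)
    (hlen : c.length = t.length) (h : (aut.term (x :: t)).Splits p c ws) :
    List.Forall₂ (fun x u => u ∈ (aut x).lang) (x :: t) ws := by
  induction t generalizing x ws with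
  | nil =>
    obtain rfl := List.length_eq_zero_iff.1 hlen
    obtain ⟨w, rfl, f, hf, h⟩ := h
    exact .cons (mem_lang_iff.2 ⟨p, hp, f, hf, h⟩) .nil
  | cons y t ih =>
    obtain ⟨p, hp, rfl⟩ := hp
    cases c with
    | nil => simp at hlen
    | cons e c =>
      simp only [List.length_cons, Nat.add_right_cancel_iff] at hlen
      obtain ⟨u, ws', rfl, ⟨f, hf, h'⟩, r, hr, c', hlen', hc⟩ | ⟨r, _, c', hlen', hc⟩ :=
        Splits.of_concat_inl (haut x) h
      · exact .cons (mem_lang_iff.2 ⟨p, hp, f, hf, h'⟩) (ih hr (hlen'.trans hlen) hc)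
      · exact (Nat.not_succ_le_self _ ((hlen'.trans (congrArg (· + 1) hlen)).symm.le.trans
          (length_le_of_splits_term haut hc))).elim

end AutAssign

/-! ### The refinement step -/

namespace AutAssign

open FinNFA

variable {A X : Type*} {aut aut' : AutAssign A X} {minimise : FinNFA A → FinNFA A}

theorem unify_cases (aut : AutAssign A X) (s : List X) (N : List (FinNFA A)) (x : X) :
    (aut.unify s N x = aut x ∧ ∀ p ∈ s.zip N, p.1 ≠ x) ∨
      ∃ M L, aut.unify s N x = interList M L ∧
        ∀ K, K ∈ M :: L ↔ ∃ p ∈ s.zip N, p.1 = x ∧ p.2 = K := by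
  classical
  have hmem : ∀ K, K ∈ (s.zip N).filterMap (fun p => if p.1 = x then some p.2 else none) ↔
      ∃ p ∈ s.zip N, p.1 = x ∧ p.2 = K := by
    intro K
    rw [List.mem_filterMap]
    refine exists_congr fun p => and_congr_right fun _ => ?_
    split_ifs with h <;> simp [h]
  rcases hl : (s.zip N).filterMap (fun p => if p.1 = x then some p.2 else none) with _ | ⟨M, L⟩
  · refine Or.inl ⟨?_, fun p hp hpx => ?_⟩
    · unfold unify
      rw [hl]
    · have := (hmem p.2).2 ⟨p, hp, hpx, rfl⟩
      rw [hl] at this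
      exact List.not_mem_nil this
  · refine Or.inr ⟨M, L, ?_, fun K => hl ▸ hmem K⟩
    unfold unify
    rw [hl]

theorem unify_of_notMem {s : List X} {N : List (FinNFA A)} {x : X} (hx : x ∉ s) :
    aut.unify s N x = aut x := by
  obtain ⟨h, -⟩ | ⟨M, L, -, h⟩ := unify_cases aut s N x
  · exact h
  · obtain ⟨p, hp, rfl, -⟩ := (h M).1 List.mem_cons_self
    exact (hx (List.of_mem_zip hp).1).elim

/-- The automaton of an occurring variable is an intersection of noodle parts. -/
theorem unify_of_mem {s : List X} {N : List (FinNFA A)} {x : X} (hx : x ∈ s)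
    (hN : N.length = s.length) :
    ∃ M L, aut.unify s N x = interList M L ∧
      ∀ K, K ∈ M :: L ↔ ∃ p ∈ s.zip N, p.1 = x ∧ p.2 = K := by
  obtain ⟨-, h⟩ | h := unify_cases aut s N x
  · rw [← List.map_fst_zip (l₁ := s) (l₂ := N) hN.ge] at hx
    obtain ⟨p, hp, rfl⟩ := List.mem_map.1 hx
    exact (h p hp rfl).elim
  · exact h

theorem forall₂_lang_unify_le (aut : AutAssign A X) {s : List X} {N : List (FinNFA A)}
    (hN : N.length = s.length) :
    List.Forall₂ (fun x K => (aut.unify s N x).lang ≤ lang K) s N := by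
  refine List.forall₂_iff_zip.2 ⟨hN.symm, fun {x K} hp w hw => ?_⟩
  obtain ⟨M, L, e, hL⟩ := unify_of_mem (aut := aut) (List.of_mem_zip hp).1 hN
  replace hw : w ∈ (aut.unify s N x).lang := hw
  rw [e, mem_lang_interList] at hw
  exact hw K ((hL K).2 ⟨_, hp, rfl, rfl⟩)

theorem forall₂_mem_lang_of_unify {s : List X} {N : List (FinNFA A)}
    (hN : N.length = s.length) {ws : List (List A)}
    (h : List.Forall₂ (fun x w => w ∈ (aut.unify s N x).lang) s ws) :
    List.Forall₂ (fun w K => w ∈ lang K) ws N := by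
  have hle := forall₂_lang_unify_le aut hN
  revert hle h
  generalize aut.unify s N = aut'
  intro h hle
  clear hN
  induction h generalizing N with
  | nil =>
    cases hle
    exact .nil
  | cons hw _ ih =>
    obtain _ | ⟨hK, hle⟩ := hle
    exact .cons (hK hw) (ih hle)

theorem mem_lang_unify_of_forall₂ {s : List X} {N : List (FinNFA A)} {ν : X → List A}
    (h : List.Forall₂ (fun w K => w ∈ lang K) (s.map ν) N) :
    ∀ x ∈ s, ν x ∈ (aut.unify s N x).lang := by
  obtain ⟨hlen, h⟩ := List.forall₂_iff_zip.1 (List.forall₂_map_left_iff.1 h)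
  intro x hx
  obtain ⟨M, L, e, hL⟩ := unify_of_mem (aut := aut) hx hlen.symm
  rw [e, mem_lang_interList]
  intro K hK
  obtain ⟨⟨y, K⟩, hp, rfl, rfl⟩ := (hL K).1 hK
  exact h hp

/-- The noodles of a product for `s` have one part for each variable of `s`. -/
theorem length_segments_of_length {M : FinNFA A} {S : Set M.State} {x : X} {s : List X}
    {c : List (M.State × M.State)} (h : c.length = (x :: s).length - 1) :
    (M.segments S c).length = (x :: s).length := by
  rw [length_segments, h, List.length_cons, Nat.add_sub_cancel]

theorem finite_refine (aut : AutAssign A X) (s t : List X) :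
    (aut.refine minimise s t).Finite := by
  set P := (aut.term s).inter (minimise (aut.term t))
  have := P.finite
  have hfin : {c : List (P.State × P.State) | c.length = s.length - 1}.Finite :=
    List.finite_length_eq _ _
  refine (hfin.image fun c => aut.unify s (P.segments P.nfa.start c)).subset ?_
  rintro _ ⟨_, ⟨c, hc, -, rfl⟩, rfl, -⟩
  exact ⟨c, hc, rfl⟩

/-- Refinement loses no solution: a run that accepts the common value of `s` and `t` is cut at the
borders of the variables of `s`, and the noodle of this cut accepts the values of the variables. -/
theorem exists_mem_refine (hmin : IsReduction minimise) {s t : List X} {ν : X → List A}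
    (hν : ∀ x, ν x ∈ (aut x).lang) (hst : s.flatMap ν = t.flatMap ν) :
    ∃ aut' ∈ aut.refine minimise s t, ∀ x, ν x ∈ (aut' x).lang := by
  have ht : s.flatMap ν ∈ (minimise (aut.term t)).lang := by
    rw [(hmin _).2, hst]
    exact flatMap_mem_lang_term fun x _ => hν x
  cases s with
  | nil =>
    have hunify : ∀ N, aut.unify [] N = aut := fun N => funext fun x => unify_of_notMem (by simp)
    have : [] ∈ ((aut.term []).inter (minimise (aut.term t))).lang :=
      mem_lang_inter.2 ⟨mem_lang_unit.2 rfl, ht⟩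
    obtain ⟨p, hp, q, hq, h⟩ := mem_lang_iff.1 this
    exact ⟨aut, ⟨_, ⟨[], rfl, ⟨p, hp, q, hq, reach_iff.2 ⟨_, h⟩⟩, rfl⟩, (hunify _).symm, [],
      mem_lang_unit.2 rfl⟩, hν⟩
  | cons x s =>
    obtain ⟨p, hp, c, hlen, hc⟩ := exists_splits_term (aut := aut) (x := x) (t := s)
      (ws := (x :: s).map ν) (by
        rw [List.forall₂_map_right_iff, List.forall₂_same]
        exact fun x _ => hν x)
    obtain ⟨p', hp', f', hf', h⟩ := mem_lang_iff.1 ht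
    obtain ⟨c', hlen', hc'⟩ := hc.inter_of_run hf' h
    have hN := hc'.forall₂_segments (S := (FinNFA.inter _ _).nfa.start) ⟨hp, hp'⟩
    have hunify := mem_lang_unify_of_forall₂ (aut := aut) hN
    refine ⟨_, ⟨_, ⟨c', hlen'.trans hlen, ⟨_, ⟨hp, hp'⟩, cutFrom_iff.2 ⟨_, hc'⟩⟩, rfl⟩, rfl,
      (x :: s).flatMap ν, flatMap_mem_lang_term hunify⟩, fun y => ?_⟩
    by_cases hy : y ∈ x :: s
    · exact hunify y hy
    · rw [unify_of_notMem hy]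
      exact hν y

theorem eq_of_mem_refine_of_notMem {s t : List X} (h : aut' ∈ aut.refine minimise s t) {x : X}
    (hx : x ∉ s) : aut' x = aut x := by
  obtain ⟨N, -, rfl, -⟩ := h
  exact unify_of_notMem hx

theorem exists_mem_lang_of_mem_refine {s t : List X} (h : aut' ∈ aut.refine minimise s t) :
    ∀ x ∈ s, ∃ w, w ∈ (aut' x).lang := by
  obtain ⟨N, -, -, w, hw⟩ := h
  obtain ⟨ws, hws, -⟩ := mem_lang_term.1 hw
  intro x hx
  obtain ⟨hlen, h⟩ := List.forall₂_iff_zip.1 hws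
  rw [← List.map_fst_zip (l₁ := s) (l₂ := ws) hlen.le] at hx
  obtain ⟨p, hp, rfl⟩ := List.mem_map.1 hx
  exact ⟨_, h hp⟩

theorem feasible_of_mem_refine {s t : List X} (h : aut' ∈ aut.refine minimise s t)
    (haut : aut.Feasible) : aut'.Feasible := by
  intro x
  by_cases hx : x ∈ s
  · exact exists_mem_lang_of_mem_refine h x hx
  · rw [eq_of_mem_refine_of_notMem h hx]
    exact haut x

/-- The automata after a refinement are ε-free: an ε-transition inside of a noodle part, together
with the cut that defines the noodle, would give a run with too many ε-transitions. -/
theorem epsFree_of_mem_refine (hmin : IsReduction minimise) (haut : ∀ x, (aut x).EpsFree)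
    {s t : List X} (h : aut' ∈ aut.refine minimise s t) (x : X) : (aut' x).EpsFree := by
  by_cases hx : x ∈ s
  · obtain ⟨_, ⟨c, hlen, ⟨p, hp, hc⟩, rfl⟩, rfl, -⟩ := h
    cases s with
    | nil => simp at hx
    | cons y s =>
      obtain ⟨M, L, e, hL⟩ := unify_of_mem (aut := aut) hx (length_segments_of_length hlen)
      rw [e]
      refine epsFree_interList fun K hK => ?_
      obtain ⟨q, hq, -, rfl⟩ := (hL K).1 hK
      by_contra hne
      obtain ⟨p', -, c', hlen', hc'⟩ := hc.exists_longer hp (List.of_mem_zip hq).2 hne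
      obtain ⟨ws, hws⟩ := cutFrom_iff.1 hc'
      have := length_le_of_splits_term haut (hws.fst (hmin _).1)
      rw [List.length_map, hlen', hlen, List.length_cons] at this
      omega
  · rw [eq_of_mem_refine_of_notMem h hx]
    exact haut x

theorem lang_le_of_mem_refine (hmin : IsReduction minimise) (haut : ∀ x, (aut x).EpsFree)
    {s t : List X} (h : aut' ∈ aut.refine minimise s t) (x : X) :
    (aut' x).lang ≤ (aut x).lang := by
  classical
  by_cases hx : x ∈ s
  · intro w hw
    have hne := exists_mem_lang_of_mem_refine h
    obtain ⟨N, ⟨c, hlen, ⟨p, hp, hc⟩, hN⟩, rfl, -⟩ := h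
    cases s with
    | nil => simp at hx
    | cons y s =>
      -- accepted words for all variables of `s`, with the given word for `x`
      choose! ν hν using hne
      have hν' : List.Forall₂ (fun z u => u ∈ lang (aut.unify (y :: s) N z)) (y :: s)
          ((y :: s).map (Function.update ν x w)) := by
        rw [List.forall₂_map_right_iff, List.forall₂_same]
        intro z hz
        obtain rfl | hzx := eq_or_ne z x
        · rw [Function.update_self]
          exact hw
        · rw [Function.update_of_ne hzx]
          exact hν z hz
      have hws := forall₂_mem_lang_of_unify (hN ▸ length_segments_of_length hlen) hν'
      rw [hN] at hws
      obtain ⟨p', hp', hsplit⟩ := hc.exists_splits hws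
      have := forall₂_of_splits_term haut hp'.1
        (by rw [List.length_map, hlen, List.length_cons, Nat.add_sub_cancel])
        (hsplit.fst (hmin _).1)
      rw [List.forall₂_map_right_iff, List.forall₂_same] at this
      have hxw := this x hx
      rwa [Function.update_self] at hxw
  · rw [eq_of_mem_refine_of_notMem h hx]

/-- After a refinement the left-hand side is included in the old language of the right-hand
side. -/
theorem lang_term_le_of_mem_refine (hmin : IsReduction minimise) {s t : List X}
    (h : aut' ∈ aut.refine minimise s t) :
    (aut'.term s).lang ≤ (aut.term t).lang := by
  intro w hw
  obtain ⟨_, ⟨c, hlen, ⟨p, hp, hc⟩, rfl⟩, rfl, -⟩ := h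
  cases s with
  | nil =>
    obtain rfl : c = [] := List.length_eq_zero_iff.1 hlen
    obtain rfl : w = [] := mem_lang_unit.1 hw
    obtain ⟨f, hf, hr⟩ := hc
    obtain ⟨w, hr⟩ := reach_iff.1 hr
    obtain ⟨h₁, h₂⟩ := mem_lang_inter.1 (mem_lang_iff.2 ⟨p, hp, f, hf, hr⟩)
    obtain rfl : w = [] := mem_lang_unit.1 h₁
    rwa [(hmin _).2] at h₂
  | cons y s =>
    obtain ⟨ws, hws, rfl⟩ := mem_lang_term.1 hw
    obtain ⟨p', hp', hsplit⟩ :=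
      hc.exists_splits (forall₂_mem_lang_of_unify (length_segments_of_length hlen) hws)
    obtain ⟨f, hf, hr⟩ := hsplit.run
    rw [← (hmin _).2]
    exact (mem_lang_inter.1 (mem_lang_iff.2 ⟨p', hp', f, hf, hr⟩)).2

end AutAssign

/-! ### Termination of transition systems -/

theorem Acc.not_exists_infinite {S : Type*} {Step : S → S → Prop} {s : S}
    (h : Acc (fun b a => Step a b) s) :
    ¬ ∃ f : ℕ → S, f 0 = s ∧ ∀ n, Step (f n) (f (n + 1)) := by
  induction h with
  | intro s _ ih =>
    rintro ⟨f, rfl, hf⟩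
    exact ih _ (hf 0) ⟨fun n => f (n + 1), rfl, fun n => hf (n + 1)⟩

theorem Acc.exists_terminal {S : Type*} {Step : S → S → Prop} {s : S}
    (h : Acc (fun b a => Step a b) s) :
    ∃ t, Relation.ReflTransGen Step s t ∧ ∀ u, ¬ Step t u := by
  induction h with
  | intro s _ ih =>
    by_cases hs : ∃ u, Step s u
    · obtain ⟨u, hu⟩ := hs
      obtain ⟨t, ht, h⟩ := ih u hu
      exact ⟨t, .head hu ht, h⟩
    · exact ⟨s, .refl, not_exists.1 hs⟩

theorem wellFounded_of_acyclic {V : Type*} [Finite V] {E : V → V → Prop}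
    (h : ∀ v, ¬ Relation.TransGen E v v) : WellFounded E := by
  have : Std.Irrefl (Relation.TransGen E) := ⟨h⟩
  exact Subrelation.wf Relation.TransGen.single
    (Finite.wellFounded_of_trans_of_irrefl (Relation.TransGen E))

theorem wellFounded_swap_of_acyclic {V : Type*} [Finite V] {E : V → V → Prop}
    (h : ∀ v, ¬ Relation.TransGen E v v) : WellFounded (Function.swap E) :=
  wellFounded_of_acyclic fun v hv => h v (Relation.transGen_swap.1 hv)

namespace EqSystem

variable {A X : Type*} {Φ : EqSystem X} {minimise : FinNFA A → FinNFA A}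

@[simp] theorem dual_dual (v : Φ.Node) : Φ.dual (Φ.dual v) = v := by simp [dual]

theorem dual_ne (v : Φ.Node) : Φ.dual v ≠ v := by
  simp [dual, Prod.ext_iff]

/-! ### Termination of `propagate` -/

/-- The node queues of the branches. -/
def nodeQueues (Q : List (AutAssign A X × List Φ.Node)) : Multiset (Multiset Φ.Node) :=
  (Q.map fun b => (b.2 : Multiset Φ.Node) : List (Multiset Φ.Node))

/-- Each iteration replaces one branch by finitely many branches, and in the queues of these one
node is replaced by finitely many successors of it. -/
theorem PropagateStep.cutExpand {G : Φ.Graph} {Q Q' : List (AutAssign A X × List Φ.Node)}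
    (h : PropagateStep minimise G (.running Q) (.running Q')) :
    Relation.CutExpand (Relation.CutExpand (Function.swap G.E)) (nodeQueues Q') (nodeQueues Q) := by
  cases h with
  | skip aut v W Q h =>
    refine ⟨{(W : Multiset Φ.Node)}, ((v :: W : List Φ.Node) : Multiset Φ.Node), ?_, ?_⟩
    · intro a ha
      rw [Multiset.mem_singleton.1 ha]
      refine ⟨0, v, by simp, ?_⟩
      rw [add_zero, ← Multiset.cons_coe, add_comm, Multiset.singleton_add]
    · simp only [nodeQueues, List.map_append, List.map_cons, List.map_nil, ← Multiset.coe_add,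
        ← Multiset.cons_coe, Multiset.coe_nil, ← Multiset.singleton_add]
      abel
  | refine aut v W Q h T hTn hT U hUn hU =>
    refine ⟨((T.map fun _ => ((W ++ U : List Φ.Node) : Multiset Φ.Node) :
      List (Multiset Φ.Node)) : Multiset (Multiset Φ.Node)),
      ((v :: W : List Φ.Node) : Multiset Φ.Node), ?_, ?_⟩
    · intro a ha
      obtain ⟨_, -, rfl⟩ := List.mem_map.1 (Multiset.mem_coe.1 ha)
      refine ⟨(U : Multiset Φ.Node), v, fun u hu => ((hU u).1 hu).1, ?_⟩
      rw [← Multiset.coe_add, ← Multiset.cons_coe, ← Multiset.singleton_add]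
      abel
    · simp only [nodeQueues, List.map_append, List.map_cons, ← Multiset.coe_add, List.map_map,
        ← Multiset.cons_coe, ← Multiset.singleton_add, Function.comp_def]
      abel

theorem acc_propagateStep {G : Φ.Graph} (hG : G.Acyclic)
    (Q : List (AutAssign A X × List Φ.Node)) :
    Acc (fun q p => PropagateStep minimise G p q) (.running Q) := by
  have hwf := (wellFounded_swap_of_acyclic hG).cutExpand.cutExpand
  generalize hM : nodeQueues Q = M
  induction M using hwf.induction generalizing Q with
  | _ M ih =>
    subst hM
    refine ⟨_, fun p hp => ?_⟩
    cases p with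
    | running Q' => exact ih _ hp.cutExpand Q' rfl
    | sat => exact ⟨_, fun p hp => nomatch hp⟩
    | unsat => exact ⟨_, fun p hp => nomatch hp⟩

/-- The loop is never stuck, since a refinement yields only finitely many assignments. -/
theorem exists_propagateStep (G : Φ.Graph) (Q : List (AutAssign A X × List Φ.Node)) :
    ∃ p, PropagateStep minimise G (.running Q) p := by
  classical
  rcases Q with _ | ⟨⟨aut, _ | ⟨v, W⟩⟩, Q⟩
  · exact ⟨_, .returnUnsat⟩
  · exact ⟨_, .returnSat aut Q⟩
  · by_cases h : (aut.term (Φ.lhs v)).lang ≤ (aut.term (Φ.rhs v)).lang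
    · exact ⟨_, .skip aut v W Q h⟩
    · have hfin := AutAssign.finite_refine (minimise := minimise) aut (Φ.lhs v) (Φ.rhs v)
      exact ⟨_, .refine aut v W Q h hfin.toFinset.toList (Finset.nodup_toList _) (by simp)
        (Finset.univ.filter fun u => G.E v u ∧ u ∉ W).toList (Finset.nodup_toList _) (by simp)⟩

theorem propagateTerminates_of_acyclic {G : Φ.Graph} (hG : G.Acyclic) (aut : AutAssign A X) :
    PropagateTerminates minimise G aut := by
  refine fun order _ => ⟨(acc_propagateStep hG _).not_exists_infinite, fun p _ hp => ?_⟩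
  cases p with
  | running Q =>
    obtain ⟨p, h⟩ := exists_propagateStep (minimise := minimise) G Q
    exact (hp p h).elim
  | sat => exact Or.inl rfl
  | unsat => exact Or.inr rfl

/-! ### The answers of `propagate` -/

/-- A solution of the constraints is never lost: as long as no answer is given, some branch admits
it. -/
def KeepsSolution (ν : X → List A) : PState A Φ → Prop
  | .running Q => ∃ b ∈ Q, ∀ x, ν x ∈ (b.1 x).lang
  | .sat => True
  | .unsat => False

theorem Solves.flatMap_eq {ν : X → List A} (h : Φ.Solves ν) (v : Φ.Node) :
    (Φ.lhs v).flatMap ν = (Φ.rhs v).flatMap ν := by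
  obtain ⟨i, _ | _⟩ := v
  · exact (h i).symm
  · exact h i

theorem PropagateStep.keepsSolution (hmin : IsReduction minimise) {G : Φ.Graph} {ν : X → List A}
    (hν : Φ.Solves ν) {p q : PState A Φ} (h : PropagateStep minimise G p q)
    (hp : KeepsSolution ν p) : KeepsSolution ν q := by
  cases h with
  | returnUnsat =>
    obtain ⟨_, hb, -⟩ := hp
    exact List.not_mem_nil hb
  | returnSat => trivial
  | skip aut v W Q h =>
    obtain ⟨b, hb, hbν⟩ := hp
    obtain rfl | hb := List.mem_cons.1 hb
    · exact ⟨(aut, W), by simp, hbν⟩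
    · exact ⟨b, by simp [hb], hbν⟩
  | refine aut v W Q h T hTn hT U hUn hU =>
    obtain ⟨b, hb, hbν⟩ := hp
    obtain rfl | hb := List.mem_cons.1 hb
    · obtain ⟨aut', haut', h'⟩ := AutAssign.exists_mem_refine hmin hbν (hν.flatMap_eq v)
      exact ⟨(aut', W ++ U), List.mem_append_right _
        (List.mem_map.2 ⟨aut', (hT aut').2 haut', rfl⟩), h'⟩
    · exact ⟨b, List.mem_append_left _ hb, hbν⟩

theorem not_satisfiable_of_propagateReturns_unsat (hmin : IsReduction minimise) {G : Φ.Graph}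
    {aut : AutAssign A X} (h : PropagateReturns minimise G aut .unsat) :
    ¬ Φ.Satisfiable aut := by
  rintro ⟨ν, hν, haut⟩
  obtain ⟨order, -, h⟩ := h
  have key : ∀ p, Relation.ReflTransGen (PropagateStep minimise G) (propagateInit aut order) p →
      KeepsSolution ν p := by
    intro p h
    induction h with
    | refl => exact ⟨(aut, order), by simp, haut⟩
    | tail _ h ih => exact h.keepsSolution hmin hν ih
  exact key _ h

/-- What holds for every branch of `propagate` started with the assignment `aut`: its automata are
ε-free, accept nonempty subsets of the original languages, and all inclusions outside of the queue
hold. -/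
structure GoodBranch (G : Φ.Graph) (aut : AutAssign A X) (b : AutAssign A X × List Φ.Node) :
    Prop where
  epsFree : ∀ x, (b.1 x).EpsFree
  feasible : b.1.Feasible
  lang_le : ∀ x, (b.1 x).lang ≤ (aut x).lang
  mem : ∀ v ∈ b.2, v ∈ G.V
  incl : ∀ v ∈ G.V, v ∉ b.2 → (b.1.term (Φ.lhs v)).lang ≤ (b.1.term (Φ.rhs v)).lang

/-- After a refinement for `v` only the inclusions whose right-hand side shares a variable with the
left-hand side of `v` can fail, and these are the successors of `v`. -/
theorem GoodBranch.refine (hmin : IsReduction minimise) {G : Φ.Graph}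
    (hE : ∀ v w, G.E v w ↔ v ∈ G.V ∧ w ∈ G.V ∧ ∃ x, x ∈ Φ.lhs v ∧ x ∈ Φ.rhs w)
    {aut aut₁ aut₂ : AutAssign A X} {v : Φ.Node} {W U : List Φ.Node}
    (h : GoodBranch G aut (aut₁, v :: W)) (h₂ : aut₂ ∈ aut₁.refine minimise (Φ.lhs v) (Φ.rhs v))
    (hU : ∀ u, u ∈ U ↔ G.E v u ∧ u ∉ W) : GoodBranch G aut (aut₂, W ++ U) where
  epsFree := AutAssign.epsFree_of_mem_refine hmin h.epsFree h₂
  feasible := AutAssign.feasible_of_mem_refine h₂ h.feasible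
  lang_le x := (AutAssign.lang_le_of_mem_refine hmin h.epsFree h₂ x).trans (h.lang_le x)
  mem u hu := by
    obtain hu | hu := List.mem_append.1 hu
    · exact h.mem u (List.mem_cons_of_mem _ hu)
    · exact ((hE v u).1 ((hU u).1 hu).1).2.1
  incl u hu hu' := by
    simp only [List.mem_append, hU, not_or, not_and, not_not] at hu'
    have hdisj : ∀ x ∈ Φ.rhs u, x ∉ Φ.lhs v := fun x hx hx' =>
      hu'.1 (hu'.2 ((hE v u).2 ⟨h.mem v List.mem_cons_self, hu, x, hx', hx⟩))
    have hrhs : (aut₁.term (Φ.rhs u)).lang ≤ (aut₂.term (Φ.rhs u)).lang :=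
      AutAssign.lang_term_mono fun x hx =>
        (AutAssign.eq_of_mem_refine_of_notMem h₂ (hdisj x hx)).symm ▸ le_rfl
    refine le_trans ?_ hrhs
    by_cases huv : u = v
    · subst huv
      exact AutAssign.lang_term_le_of_mem_refine hmin h₂
    · exact (AutAssign.lang_term_mono fun x _ =>
        AutAssign.lang_le_of_mem_refine hmin h.epsFree h₂ x).trans
          (h.incl u hu (by simp [huv, hu'.1]))

/-- All branches are good, and the answer `sat` is given for a branch with empty queue. -/
def GoodState (G : Φ.Graph) (aut : AutAssign A X) : PState A Φ → Prop
  | .running Q => ∀ b ∈ Q, GoodBranch G aut b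
  | .sat => ∃ aut', GoodBranch G aut (aut', [])
  | .unsat => True

theorem PropagateStep.goodState (hmin : IsReduction minimise) {G : Φ.Graph}
    (hE : ∀ v w, G.E v w ↔ v ∈ G.V ∧ w ∈ G.V ∧ ∃ x, x ∈ Φ.lhs v ∧ x ∈ Φ.rhs w)
    {aut : AutAssign A X} {p q : PState A Φ} (h : PropagateStep minimise G p q)
    (hp : GoodState G aut p) : GoodState G aut q := by
  cases h with
  | returnUnsat => trivial
  | returnSat aut' Q => exact ⟨aut', hp _ List.mem_cons_self⟩
  | skip aut' v W Q h =>
    obtain ⟨hb, hQ⟩ := List.forall_mem_cons.1 hp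
    intro b hbQ
    obtain hbQ | hbQ := List.mem_append.1 hbQ
    · exact hQ b hbQ
    · obtain rfl := List.mem_singleton.1 hbQ
      refine ⟨hb.epsFree, hb.feasible, hb.lang_le,
        fun u hu => hb.mem u (List.mem_cons_of_mem _ hu), fun u hu huW => ?_⟩
      by_cases huv : u = v
      · subst huv
        exact h
      · exact hb.incl u hu (by simp [huv, huW])
  | refine aut' v W Q h T hTn hT U hUn hU =>
    obtain ⟨hb, hQ⟩ := List.forall_mem_cons.1 hp
    intro b hbQ
    obtain hbQ | hbQ := List.mem_append.1 hbQ
    · exact hQ b hbQ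
    · obtain ⟨aut₂, h₂, rfl⟩ := List.mem_map.1 hbQ
      exact hb.refine hmin hE ((hT _).1 h₂) hU

theorem exists_goodBranch_of_propagateReturns_sat (hmin : IsReduction minimise) {G : Φ.Graph}
    (hE : ∀ v w, G.E v w ↔ v ∈ G.V ∧ w ∈ G.V ∧ ∃ x, x ∈ Φ.lhs v ∧ x ∈ Φ.rhs w)
    {aut : AutAssign A X} (haut : ∀ x, (aut x).EpsFree) (hf : aut.Feasible)
    (h : PropagateReturns minimise G aut .sat) : ∃ aut', GoodBranch G aut (aut', []) := by
  obtain ⟨order, ⟨-, horder⟩, h⟩ := h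
  have key : ∀ p, Relation.ReflTransGen (PropagateStep minimise G) (propagateInit aut order) p →
      GoodState G aut p := by
    intro p h
    induction h with
    | refl =>
      intro b hb
      obtain rfl := List.mem_singleton.1 hb
      exact ⟨haut, hf, fun _ => le_rfl, fun v => (horder v).1,
        fun v hv hv' => (hv' ((horder v).2 hv)).elim⟩
    | tail _ h ih => exact h.goodState hmin hE ih
  exact key _ h

/-! ### Solutions from stable assignments -/

/-- A word of the language of a term without repeated variables is the value of the term for some
choice of the values of these variables. -/
theorem exists_flatMap_eq_of_mem_lang_term {aut : AutAssign A X} {t : List X} (ht : t.Nodup)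
    {w : List A} (hw : w ∈ (aut.term t).lang) (ν : X → List A) :
    ∃ ν' : X → List A, (∀ x ∉ t, ν' x = ν x) ∧ (∀ x ∈ t, ν' x ∈ (aut x).lang) ∧
      t.flatMap ν' = w := by
  classical
  induction t generalizing w with
  | nil =>
    obtain rfl := FinNFA.mem_lang_unit.1 hw
    exact ⟨ν, fun _ _ => rfl, by simp, rfl⟩
  | cons x t ih =>
    obtain ⟨u, hu, v, hv, rfl⟩ := AutAssign.mem_lang_term_cons.1 hw
    obtain ⟨hx, ht⟩ := List.nodup_cons.1 ht
    obtain ⟨ν', hν₁, hν₂, rfl⟩ := ih ht hv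
    have hne : ∀ y ∈ t, y ≠ x := fun y hy e => hx (e ▸ hy)
    refine ⟨Function.update ν' x u, fun y hy => ?_, fun y hy => ?_, ?_⟩
    · rw [List.mem_cons, not_or] at hy
      rw [Function.update_of_ne hy.1, hν₁ y hy.2]
    · obtain rfl | hy := List.mem_cons.1 hy
      · rwa [Function.update_self]
      · rw [Function.update_of_ne (hne y hy)]
        exact hν₂ y hy
    · rw [List.flatMap_cons, Function.update_self]
      congr 1
      exact List.flatMap_congr fun y hy => Function.update_of_ne (hne y hy) _ _

/-- No variable has two occurrences on the right-hand sides of the vertices in `V`. -/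
def RhsLinear (V : Finset Φ.Node) : Prop :=
  ∀ u ∈ V, ∀ w ∈ V, ∀ (x : X) (k l : ℕ), (Φ.rhs u)[k]? = some x → (Φ.rhs w)[l]? = some x →
    (u, k) = (w, l)

theorem RhsLinear.nodup {V : Finset Φ.Node} (hV : RhsLinear V) {v : Φ.Node} (hv : v ∈ V) :
    (Φ.rhs v).Nodup := by
  refine List.nodup_iff_getElem?_ne_getElem?.2 fun i j hij hj h => ?_
  have hx := List.getElem?_eq_getElem hj
  have := hV v hv v hv _ i j (h.trans hx) hx
  exact hij.ne (Prod.mk.inj this).2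

theorem RhsLinear.eq_of_mem {V : Finset Φ.Node} (hV : RhsLinear V) {u v : Φ.Node} (hu : u ∈ V)
    (hv : v ∈ V) {x : X} (hxu : x ∈ Φ.rhs u) (hxv : x ∈ Φ.rhs v) : u = v := by
  obtain ⟨k, hk⟩ := List.getElem?_of_mem hxu
  obtain ⟨l, hl⟩ := List.getElem?_of_mem hxv
  exact (Prod.mk.inj (hV u hu v hv x k l hk hl)).1

/-- The inclusions are made true one after the other, in an order in which every vertex comes after
its successors. When `v` is treated, only variables of its right-hand side get new values; they
occur neither on the left-hand side of `v` nor in an inclusion treated before. -/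
theorem exists_solution_of_stable {V : Finset Φ.Node} (hV : RhsLinear V)
    (hacyc : (Φ.graphOn V).Acyclic) {aut : AutAssign A X} (hf : aut.Feasible)
    (hincl : ∀ v ∈ V, (aut.term (Φ.lhs v)).lang ≤ (aut.term (Φ.rhs v)).lang) :
    ∃ ν : X → List A, (∀ x, ν x ∈ (aut x).lang) ∧
      ∀ v ∈ V, (Φ.lhs v).flatMap ν = (Φ.rhs v).flatMap ν := by
  classical
  suffices key : ∀ n, ∀ S ⊆ V, S.card = n → ∃ ν : X → List A, (∀ x, ν x ∈ (aut x).lang) ∧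
      ∀ v ∈ S, (Φ.lhs v).flatMap ν = (Φ.rhs v).flatMap ν from key _ V subset_rfl rfl
  intro n
  induction n with
  | zero =>
    intro S _ hS
    obtain rfl := Finset.card_eq_zero.1 hS
    choose ν hν using hf
    exact ⟨ν, hν, by simp⟩
  | succ n ih =>
    intro S hSV hS
    obtain ⟨v, hv, hmin⟩ := (wellFounded_of_acyclic hacyc).has_min (S : Set Φ.Node)
      (Finset.card_pos.1 (by omega))
    have hvS : v ∈ S := hv
    obtain ⟨ν, hν, hsol⟩ := ih (S.erase v) ((Finset.erase_subset _ _).trans hSV)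
      (by rw [Finset.card_erase_of_mem hvS, hS, Nat.add_sub_cancel])
    obtain ⟨ν', h₁, h₂, h₃⟩ := exists_flatMap_eq_of_mem_lang_term (hV.nodup (hSV hvS))
      (hincl v (hSV hvS) (AutAssign.flatMap_mem_lang_term fun x _ => hν x)) ν
    have hlhs : ∀ u ∈ S, (Φ.lhs u).flatMap ν' = (Φ.lhs u).flatMap ν := fun u hu =>
      List.flatMap_congr fun x hx => h₁ x fun hx' => hmin u hu ⟨hSV hu, hSV hvS, x, hx, hx'⟩
    refine ⟨ν', fun x => ?_, fun u hu => ?_⟩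
    · by_cases hx : x ∈ Φ.rhs v
      · exact h₂ x hx
      · rw [h₁ x hx]
        exact hν x
    · rw [hlhs u hu]
      by_cases huv : u = v
      · rw [huv, h₃]
      · rw [hsol u (Finset.mem_erase.2 ⟨huv, hu⟩)]
        exact List.flatMap_congr fun x hx =>
          (h₁ x fun hx' => huv (hV.eq_of_mem (hSV hu) (hSV hvS) hx hx')).symm

/-! ### The graphs returned by `incl` -/

/-- The loop invariant of `incl`, for the remaining nodes `R` and the chosen nodes `V`. -/
structure InclInv (R V : Finset Φ.Node) : Prop where
  dual_mem : ∀ v ∈ R, Φ.dual v ∈ R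
  cover : ∀ v, v ∈ R ∨ v ∈ V ∨ Φ.dual v ∈ V
  notMem : ∀ v ∈ V, v ∉ R
  dual_notMem : ∀ v ∈ V, Φ.dual v ∉ V
  rhsLinear : RhsLinear V
  disjoint : ∀ v ∈ V, ∀ u ∈ R, ∀ x ∈ Φ.rhs v, x ∉ Φ.rhs u

theorem inclInv_init : InclInv (Finset.univ : Finset Φ.Node) ∅ where
  dual_mem := by simp
  cover := by simp
  notMem := by simp
  dual_notMem := by simp
  rhsLinear := by simp [RhsLinear]
  disjoint := by simp

/-- A further occurrence of a variable of `rhs v` on some `rhs u` would be one on the left-hand side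
of the dual of `u`, and so give an edge from this dual to `v`. -/
theorem TrivialSource.eq_of_getElem? {R : Finset Φ.Node} {u v : Φ.Node}
    (h : Φ.TrivialSource R v) (hu : Φ.dual u ∈ R) {x : X} {k l : ℕ}
    (hk : (Φ.rhs u)[k]? = some x) (hl : (Φ.rhs v)[l]? = some x) : (u, k) = (v, l) := by
  by_contra hne
  have hedge : Φ.SplitEdge (Φ.dual u) v := by
    refine ⟨x, k, l, hk, hl, fun e => hne ?_⟩
    obtain ⟨e', rfl⟩ := Prod.mk.inj e
    rw [← dual_dual u, e', dual_dual]
  by_cases huv : Φ.dual u = v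
  · exact h.2.1 (huv ▸ hedge)
  · exact h.2.2 _ hu huv hedge

theorem InclInv.step {R V : Finset Φ.Node} (h : InclInv R V) {v : Φ.Node}
    (hv : Φ.TrivialSource R v) : InclInv (R \ {v, Φ.dual v}) (V ∪ {v}) where
  dual_mem u hu := by
    simp only [Finset.mem_sdiff, Finset.mem_insert, Finset.mem_singleton, not_or] at hu ⊢
    refine ⟨h.dual_mem u hu.1, fun e => hu.2.2 ?_, fun e => hu.2.1 ?_⟩
    · rw [← e, dual_dual]
    · rw [← dual_dual u, e, dual_dual]
  cover u := by
    simp only [Finset.mem_sdiff, Finset.mem_insert, Finset.mem_singleton, Finset.mem_union]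
    by_cases h₁ : u = v
    · exact Or.inr (Or.inl (Or.inr h₁))
    by_cases h₂ : u = Φ.dual v
    · exact Or.inr (Or.inr (Or.inr (by rw [h₂, dual_dual])))
    obtain h | h | h := h.cover u
    · exact Or.inl ⟨h, by simp [h₁, h₂]⟩
    · exact Or.inr (Or.inl (Or.inl h))
    · exact Or.inr (Or.inr (Or.inl h))
  notMem u hu hu' := by
    simp only [Finset.mem_sdiff, Finset.mem_insert, Finset.mem_singleton, not_or] at hu'
    obtain hu | hu := Finset.mem_union.1 hu
    · exact h.notMem u hu hu'.1
    · exact hu'.2.1 (Finset.mem_singleton.1 hu)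
  dual_notMem u hu hu' := by
    simp only [Finset.mem_union, Finset.mem_singleton] at hu hu'
    obtain hu | rfl := hu
    · obtain hu' | rfl := hu'
      · exact h.dual_notMem u hu hu'
      · refine h.notMem u hu ?_
        rw [← dual_dual u]
        exact h.dual_mem _ hv.1
    · obtain hu' | hu' := hu'
      · exact h.notMem _ hu' (h.dual_mem _ hv.1)
      · exact dual_ne u hu'
  rhsLinear u hu w hw x k l hk hl := by
    simp only [Finset.mem_union, Finset.mem_singleton] at hu hw
    obtain hu | rfl := hu
    · obtain hw | rfl := hw
      · exact h.rhsLinear u hu w hw x k l hk hl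
      · exact (h.disjoint u hu w hv.1 x (List.mem_of_getElem? hk)
          (List.mem_of_getElem? hl)).elim
    · obtain hw | rfl := hw
      · exact (h.disjoint w hw u hv.1 x (List.mem_of_getElem? hl)
          (List.mem_of_getElem? hk)).elim
      · exact hv.eq_of_getElem? (h.dual_mem _ hv.1) hk hl
  disjoint w hw u hu x hxw hxu := by
    simp only [Finset.mem_sdiff, Finset.mem_insert, Finset.mem_singleton, not_or] at hu
    obtain hw | hw := Finset.mem_union.1 hw
    · exact h.disjoint w hw u hu.1 x hxw hxu
    · obtain rfl := Finset.mem_singleton.1 hw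
      obtain ⟨k, hk⟩ := List.getElem?_of_mem hxu
      obtain ⟨l, hl⟩ := List.getElem?_of_mem hxw
      exact hu.2.1 (Prod.mk.inj (hv.eq_of_getElem? (h.dual_mem u hu.1) hk hl)).1

theorem inclInv_of_reflTransGen {p : Finset Φ.Node × Finset Φ.Node}
    (h : Relation.ReflTransGen Φ.InclStep Φ.inclInit p) : InclInv p.1 p.2 := by
  induction h with
  | refl => exact inclInv_init
  | tail _ h ih =>
    obtain ⟨v, hv, rfl⟩ := h
    exact ih.step hv

theorem acc_inclStep (p : Finset Φ.Node × Finset Φ.Node) :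
    Acc (fun q p => Φ.InclStep p q) p := by
  refine Subrelation.accessible ?_ (InvImage.accessible Prod.fst
    ((wellFounded_lt : WellFounded ((· < ·) : Finset Φ.Node → Finset Φ.Node → Prop)).apply p.1))
  rintro q p ⟨v, hv, rfl⟩
  exact Finset.ssubset_iff_subset_ne.2 ⟨Finset.sdiff_subset, fun e =>
    (Finset.mem_sdiff.1 (e.symm ▸ hv.1)).2 (Finset.mem_insert_self _ _)⟩

theorem inclTerminates (Φ : EqSystem X) : Φ.InclTerminates :=
  (acc_inclStep Φ.inclInit).not_exists_infinite

theorem exists_inclReturns (Φ : EqSystem X) : ∃ G, Φ.InclReturns G := by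
  obtain ⟨⟨R, V⟩, h, hterm⟩ := (acc_inclStep Φ.inclInit).exists_terminal
  exact ⟨_, R, V, h, fun v hv => hterm _ ⟨v, hv, rfl⟩, rfl⟩

/-- For a chain-free system all nodes are removed from the splitting graph, as an acyclic finite
graph has a source. -/
theorem ChainFree.exists_of_inclReturns (hΦ : Φ.ChainFree) {G : Φ.Graph}
    (hG : Φ.InclReturns G) : ∃ V, InclInv ∅ V ∧ G = Φ.graphOn V := by
  obtain ⟨R, V, h, hR, rfl⟩ := hG
  obtain rfl : R = ∅ := by
    by_contra hne
    obtain ⟨v, hv, hmin⟩ := (wellFounded_of_acyclic hΦ).has_min (R : Set Φ.Node)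
      (Finset.nonempty_iff_ne_empty.2 hne)
    exact hR v ⟨hv, hmin v hv, fun u hu _ => hmin u hu⟩
  exact ⟨V, inclInv_of_reflTransGen h, by rw [Finset.union_empty]⟩

/-- As no two dual inclusions are chosen, all edges are edges of the splitting graph. -/
theorem InclInv.acyclic {R V : Finset Φ.Node} (h : InclInv R V) (hΦ : Φ.ChainFree) :
    (Φ.graphOn V).Acyclic := by
  refine fun v hv => hΦ v (Relation.TransGen.mono ?_ _ _ hv)
  rintro u w ⟨hu, hw, x, hxu, hxw⟩
  obtain ⟨k, hk⟩ := List.getElem?_of_mem hxu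
  obtain ⟨l, hl⟩ := List.getElem?_of_mem hxw
  refine ⟨x, k, l, hk, hl, fun e => h.dual_notMem w hw ?_⟩
  rw [← (Prod.mk.inj e).1]
  exact hu

theorem InclInv.isInclusionGraph {V : Finset Φ.Node} (h : InclInv ∅ V) (hΦ : Φ.ChainFree) :
    Φ.IsInclusionGraph (Φ.graphOn V) where
  atLeastOne v := (h.cover v).resolve_left (Finset.notMem_empty v)
  multiOccur := by
    rintro v - ⟨x, -, u, hu, w, hw, k, l, hne, hk, hl⟩
    exact (hne (h.rhsLinear u hu w hw x k l hk hl)).elim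
  edges _ _ := Iff.rfl
  cycle v _ hv := (h.acyclic hΦ v hv).elim

theorem InclInv.satisfiable {V : Finset Φ.Node} (h : InclInv ∅ V) (hΦ : Φ.ChainFree)
    (hmin : IsReduction minimise) {aut : AutAssign A X} (haut : ∀ x, (aut x).EpsFree)
    (hf : aut.Feasible) (hsat : PropagateReturns minimise (Φ.graphOn V) aut .sat) :
    Φ.Satisfiable aut := by
  obtain ⟨aut', hgood⟩ :=
    exists_goodBranch_of_propagateReturns_sat hmin (fun _ _ => Iff.rfl) haut hf hsat
  obtain ⟨ν, hν, hsol⟩ := exists_solution_of_stable h.rhsLinear (h.acyclic hΦ) hgood.feasible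
    fun v hv => hgood.incl v hv List.not_mem_nil
  refine ⟨ν, fun i => ?_, fun x => hgood.lang_le x (hν x)⟩
  obtain hi | hi := (h.cover (i, true)).resolve_left (Finset.notMem_empty _)
  · exact hsol _ hi
  · exact (hsol _ hi).symm

end EqSystem

/-! ### Completeness for chain-free systems -/

theorem theorem7 {A X : Type*} [Finite A] (Φ : EqSystem X)
    (minimise : FinNFA A → FinNFA A) (hmin : IsReduction minimise)
    (aut : AutAssign A X) (haut : ∀ x, (aut x).EpsFree) :
    (∀ G : Φ.Graph, Φ.IsInclusionGraph G → G.Acyclic →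
      EqSystem.PropagateTerminates minimise G aut) ∧
    (Φ.ChainFree →
      Φ.InclTerminates ∧ (∃ G, Φ.InclReturns G) ∧
      ∀ G, Φ.InclReturns G →
        Φ.IsInclusionGraph G ∧ G.Acyclic ∧
        EqSystem.PropagateTerminates minimise G aut ∧
        (aut.Feasible → EqSystem.PropagateReturns minimise G aut .sat → Φ.Satisfiable aut) ∧
        (EqSystem.PropagateReturns minimise G aut .unsat → ¬ Φ.Satisfiable aut)) := by
  refine ⟨fun G _ hG => EqSystem.propagateTerminates_of_acyclic hG aut, fun hΦ =>
    ⟨EqSystem.inclTerminates Φ, EqSystem.exists_inclReturns Φ, fun G hG => ?_⟩⟩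
  obtain ⟨V, h, rfl⟩ := hΦ.exists_of_inclReturns hG
  exact ⟨h.isInclusionGraph hΦ, h.acyclic hΦ,
    EqSystem.propagateTerminates_of_acyclic (h.acyclic hΦ) aut,
    h.satisfiable hΦ hmin haut, EqSystem.not_satisfiable_of_propagateReturns_unsat hmin⟩
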